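/- **Corollary 3.3 (label duality).** All algebras are over $\mathbb{C}$, associative and unital. For $N\ge 0$ let $Y(\mathfrak{gl}_N)$ be the Yangian: the algebra generated by $t_{ij}^{(r)}$ ($1\le i,j\le N$, $r\ge 1$) with relations $$(u-v)\,[t_{ij}(u),t_{kl}(v)]=t_{kj}(u)\,t_{il}(v)-t_{kj}(v)\,t_{il}(u),\qquad t_{ij}(u)=\delta_{ij}+\sum_{r\ge 1}t_{ij}^{(r)}u^{-r}$$ (equivalently $R(u-v)T_1(u)T_2(v)=T_2(v)T_1(u)R(u-v)$ with $R(u)=u-\sum_{i,j}E_{ij}\otimes E_{ji}$), where $T(u)=(t_{ij}(u))_{i,j}$. Let $U(\mathfrak{gl}_N)$ be the universal enveloping algebra, $e_{ij}$ its standard generators and $\mathcal{Z}_N$ its center, and let $ev_N:Y(\mathfrak{gl}_N)\to U(\mathfrak{gl}_N)$ be the homomorphism $t_{ij}(u)\mapsto\delta_{ij}+e_{ij}u^{-1}$. *Bethe subalgebra.* Let $\tau$ be the shift operator $(\tau f)(u)=f(u+1)$ on $Y(\mathfrak{gl}_N)((u^{-1}))$, and let $$D_N=\sum_{\sigma\in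 S_N}(-1)^\sigma D_{\sigma(1),1}D_{\sigma(2),2}\cdots D_{\sigma(N),N},\qquad D_{ij}=\delta_{ij}\,\tau-t_{ij}(u-j+1),$$ where a series acts on $Y(\mathfrak{gl}_N)((u^{-1}))$ by left multiplication. Write $D_N=\sum_{i=0}^N(-1)^i\bigl(\sum_{j\ge0}B_{ij}u^{-j}\bigr)\tau^{N-i}$ with $B_{ij}\in Y(\mathfrak{gl}_N)$. Then $\mathcal{B}_N\subset Y(\mathfrak{gl}_N)$ is the unital subalgebra generated by all $B_{ij}$. *Embeddings.* Let $\omega_N$ be the automorphism $T(u)\mapsto T(-u)^{-1}$ of $Y(\mathfrak{gl}_N)$. For $n,m\ge 0$ let $i_n:Y(\mathfrak{gl}_n)\to Y(\mathfrak{gl}_{n+m})$, $t_{ij}(u)\mapsto t_{ij}(u)$, and $j_m:Y(\mathfrak{gl}_m)\to Y(\mathfrak{gl}_{n+m})$, $t_{ij}(u)\mapsto t_{n+i,n+j}(u)$, and put $$\phi_n=\omega_{n+m}\circ i_n\circ\omega_n,\qquad \psi_m=\omega_{n+m}\circ j_m\circ\omega_m.$$ For subalgebras $\mathcal{A},\mathcal{C}$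 of $U(\mathfrak{gl}_{n+m})$ write $\mathcal{A}\cdot\mathcal{C}$ for the subalgebra generated by $\mathcal{A}$ and $\mathcal{C}$. Then $$ev_{n+m}(\phi_n(\mathcal{B}_n))\cdot\mathcal{Z}_{n+m}=ev_{n+m}(\psi_m(\mathcal{B}_m))\cdot\mathcal{Z}_{n+m}.$$ -/

import Mathlib

open scoped PowerSeries LaurentSeries

-- An associative algebra is a Lie algebra via the commutator bracket; in particular
-- `Matrix (Fin n) (Fin n) ℂ` is the Lie algebra `gl_n`.
attribute [local instance 100] LieRing.ofAssociativeRing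

noncomputable section

namespace BetheDuality

/-! ### The Yangian of `gl_n` -/

/-- A family `t i j r` (`r ≥ 0`) in a ring is an RTT family if `t i j 0 = δ_ij` and the generating
series `t_ij(u) = ∑_r t i j r u^{-r}` satisfy the RTT relation
`R(u - v) T₁(u) T₂(v) = T₂(v) T₁(u) R(u - v)`, `R(u) = u - ∑ E_ij ⊗ E_ji`, that is,
`(u - v) [t_ij(u), t_kl(v)] = t_kj(u) t_il(v) - t_kj(v) t_il(u)`.
The field `rel` is the equality of the coefficients of `u^{-r} v^{-s}`; the coefficients in which
`u` or `v` has exponent `1` only involve commutators with `t i j 0` and hold automatically. -/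
structure IsRTT {n : ℕ} {A : Type*} [Ring A] (t : Fin n → Fin n → ℕ → A) : Prop where
  zero : ∀ i j, t i j 0 = if i = j then 1 else 0
  rel : ∀ (i j k l : Fin n) (r s : ℕ),
    (t i j (r + 1) * t k l s - t k l s * t i j (r + 1)) -
      (t i j r * t k l (s + 1) - t k l (s + 1) * t i j r) =
    t k j r * t i l s - t k j s * t i l r

/-- The family in the free algebra on the symbols `(i, j, r)`; the symbol `(i, j, r)` stands for
the generator `t_ij^{(r+1)}`, and `t_ij^{(0)} = δ_ij`. -/
def freeGen (n : ℕ) (i j : Fin n) : ℕ → FreeAlgebra ℂ (Fin n × Fin n × ℕ)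
  | 0 => if i = j then 1 else 0
  | r + 1 => FreeAlgebra.ι ℂ (i, j, r)

/-- The defining relations of the Yangian. -/
inductive YangianRel (n : ℕ) :
    FreeAlgebra ℂ (Fin n × Fin n × ℕ) → FreeAlgebra ℂ (Fin n × Fin n × ℕ) → Prop
  | rtt (i j k l : Fin n) (r s : ℕ) : YangianRel n
      ((freeGen n i j (r + 1) * freeGen n k l s - freeGen n k l s * freeGen n i j (r + 1)) -
        (freeGen n i j r * freeGen n k l (s + 1) - freeGen n k l (s + 1) * freeGen n i j r))
      (freeGen n k j r * freeGen n i l s - freeGen n k j s * freeGen n i l r)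

/-- The Yangian `Y(gl_n)` over `ℂ`. -/
abbrev Yangian (n : ℕ) : Type := RingQuot (YangianRel n)

/-- The element `t_ij^{(r)}` of the Yangian, with `t_ij^{(0)} = δ_ij`. -/
def Yangian.t {n : ℕ} (i j : Fin n) (r : ℕ) : Yangian n :=
  RingQuot.mkAlgHom ℂ (YangianRel n) (freeGen n i j r)

theorem Yangian.isRTT (n : ℕ) : IsRTT (Yangian.t (n := n)) where
  zero i j := by
    unfold Yangian.t freeGen
    split_ifs <;> simp
  rel i j k l r s := by
    have h := RingQuot.mkAlgHom_rel ℂ (YangianRel.rtt (n := n) i j k l r s)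
    simp only [map_sub, map_mul] at h
    exact h

/-- The universal property of the Yangian. -/
def Yangian.lift {n : ℕ} {A : Type*} [Ring A] [Algebra ℂ A] (t : Fin n → Fin n → ℕ → A)
    (ht : IsRTT t) : Yangian n →ₐ[ℂ] A :=
  RingQuot.liftAlgHom ℂ ⟨FreeAlgebra.lift ℂ fun p => t p.1 p.2.1 (p.2.2 + 1), by
    have key : ∀ (i j : Fin n) (r : ℕ),
        FreeAlgebra.lift ℂ (fun p : Fin n × Fin n × ℕ => t p.1 p.2.1 (p.2.2 + 1))
          (freeGen n i j r) = t i j r := by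
      intro i j r
      cases r with
      | zero => rw [ht.zero, freeGen]; split_ifs <;> simp
      | succ r => simp [freeGen]
    intro x y h
    cases h with
    | rtt i j k l r s =>
      simp only [map_sub, map_mul, key]
      exact ht.rel i j k l r s⟩

theorem Yangian.lift_t {n : ℕ} {A : Type*} [Ring A] [Algebra ℂ A] (t : Fin n → Fin n → ℕ → A)
    (ht : IsRTT t) (i j : Fin n) (r : ℕ) : Yangian.lift t ht (Yangian.t i j r) = t i j r := by
  unfold Yangian.lift Yangian.t
  rw [RingQuot.liftAlgHom_mkAlgHom_apply]
  cases r with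
  | zero => rw [ht.zero, freeGen]; split_ifs <;> simp
  | succ r => simp [freeGen]

/-! ### The automorphism `ω_n : T(u) ↦ T(-u)⁻¹` -/

/-- The series `T(u) = ∑_r T^{(r)} u^{-r}` with matrix coefficients `T^{(r)} = (t_ij^{(r)})`; the
variable of the power series is `u^{-1}`. -/
def matT {n : ℕ} {A : Type*} [Ring A] (t : Fin n → Fin n → ℕ → A) :
    (Matrix (Fin n) (Fin n) A)⟦X⟧ :=
  PowerSeries.mk fun r => Matrix.of fun i j => t i j r

/-- The inverse series `T(u)⁻¹ = ∑_k (t'_ij^{(k)}) u^{-k}` (the constant term of `T(u)` is `1`). -/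
def matTInv {n : ℕ} {A : Type*} [Ring A] (t : Fin n → Fin n → ℕ → A) :
    (Matrix (Fin n) (Fin n) A)⟦X⟧ :=
  PowerSeries.invOfUnit (matT t) 1

/-- The family `(-1)^k t'_ij^{(k)}`, that is, the coefficients of `T(-u)⁻¹`. -/
def omegaFamily {n : ℕ} {A : Type*} [Ring A] (t : Fin n → Fin n → ℕ → A) :
    Fin n → Fin n → ℕ → A :=
  fun i j k => (-1) ^ k * PowerSeries.coeff k (matTInv t) i j

theorem constantCoeff_matT {n : ℕ} {A : Type*} [Ring A] {t : Fin n → Fin n → ℕ → A}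
    (ht : IsRTT t) : PowerSeries.constantCoeff (matT t) = ((1 : (Matrix (Fin n) (Fin n) A)ˣ) :
      Matrix (Fin n) (Fin n) A) := by
  rw [← PowerSeries.coeff_zero_eq_constantCoeff_apply, matT, PowerSeries.coeff_mk]
  ext i j
  simp [ht.zero, Matrix.one_apply]

theorem matT_mul_matTInv {n : ℕ} {A : Type*} [Ring A] {t : Fin n → Fin n → ℕ → A}
    (ht : IsRTT t) : matT t * matTInv t = 1 :=
  PowerSeries.mul_invOfUnit _ _ (constantCoeff_matT ht)

theorem matTInv_mul_matT {n : ℕ} {A : Type*} [Ring A] {t : Fin n → Fin n → ℕ → A}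
    (ht : IsRTT t) : matTInv t * matT t = 1 :=
  PowerSeries.invOfUnit_mul _ _ (constantCoeff_matT ht)

/-- Inverting both sides of an RTT relation. -/
theorem rtt_inverse {M : Type*} [Ring M] (P : M) (F G F' G' : M⟦X⟧)
    (hF : F * F' = 1) (hF' : F' * F = 1) (hG : G * G' = 1) (hG' : G' * G = 1)
    (hF0 : PowerSeries.coeff 0 F = 1) (hG0 : PowerSeries.coeff 0 G = 1)
    (h : ∀ r s : ℕ,
      (F.coeff (r + 1) * G.coeff s - G.coeff s * F.coeff (r + 1)) -
        (F.coeff r * G.coeff (s + 1) - G.coeff (s + 1) * F.coeff r) =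
      P * (G.coeff s * F.coeff r) - F.coeff r * G.coeff s * P) (r s : ℕ) :
      (F'.coeff (r + 1) * G'.coeff s - G'.coeff s * F'.coeff (r + 1)) -
        (F'.coeff r * G'.coeff (s + 1) - G'.coeff (s + 1) * F'.coeff r) =
      G'.coeff s * F'.coeff r * P - P * (F'.coeff r * G'.coeff s) := by
  have hF'0 : PowerSeries.coeff 0 F' = 1 := by
    have := congrArg (PowerSeries.coeff 0) hF
    simpa [PowerSeries.coeff_mul, hF0] using this
  have hG'0 : PowerSeries.coeff 0 G' = 1 := by
    have := congrArg (PowerSeries.coeff 0) hG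
    simpa [PowerSeries.coeff_mul, hG0] using this
  -- the two variables `x = u⁻¹` and `y = v⁻¹`
  let x : M⟦X⟧⟦X⟧ := PowerSeries.C PowerSeries.X
  let y : M⟦X⟧⟦X⟧ := PowerSeries.X
  let p : M⟦X⟧⟦X⟧ := PowerSeries.C (PowerSeries.C P)
  let a : M⟦X⟧⟦X⟧ := PowerSeries.C F
  let a' : M⟦X⟧⟦X⟧ := PowerSeries.C F'
  let b : M⟦X⟧⟦X⟧ := PowerSeries.map PowerSeries.C G
  let b' : M⟦X⟧⟦X⟧ := PowerSeries.map PowerSeries.C G'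
  have haa' : a * a' = 1 := by simp only [a, a', ← map_mul, hF, map_one]
  have ha'a : a' * a = 1 := by simp only [a, a', ← map_mul, hF', map_one]
  have hbb' : b * b' = 1 := by simp only [b, b', ← map_mul, hG, map_one]
  have hb'b : b' * b = 1 := by simp only [b, b', ← map_mul, hG', map_one]
  have hx : ∀ w : M⟦X⟧⟦X⟧, w * x = x * w := by
    intro w
    ext s : 1
    simp only [x, PowerSeries.coeff_mul_C, PowerSeries.coeff_C_mul]
    exact (PowerSeries.commute_X _).eq
  have hy : ∀ w : M⟦X⟧⟦X⟧, w * y = y * w := fun w => (PowerSeries.commute_X w).eq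
  have key : y * (a * b - b * a) - x * (a * b - b * a) =
      x * (y * (p * (b * a) - a * b * p)) := by
    ext s r
    rcases s with _ | s
    · rcases r with _ | r
      · simp [x, y, p, a, b, PowerSeries.coeff_C_mul, PowerSeries.coeff_mul_C,
          PowerSeries.coeff_zero_X_mul, -PowerSeries.coeff_zero_eq_constantCoeff]
      · simp [x, y, p, a, b, PowerSeries.coeff_C_mul, PowerSeries.coeff_mul_C,
          PowerSeries.coeff_zero_X_mul, hG0,
          -PowerSeries.coeff_zero_eq_constantCoeff]
    · rcases r with _ | r
      · simp [x, y, p, a, b, PowerSeries.coeff_C_mul, PowerSeries.coeff_mul_C,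
          PowerSeries.coeff_zero_X_mul, PowerSeries.coeff_succ_X_mul, hF0,
          -PowerSeries.coeff_zero_eq_constantCoeff]
      · have := h r s
        simp only [x, y, p, a, b, PowerSeries.coeff_C_mul, PowerSeries.coeff_mul_C, map_sub,
          PowerSeries.coeff_succ_X_mul, PowerSeries.coeff_map]
        exact this
  have key' : y * (a' * b' - b' * a') - x * (a' * b' - b' * a') =
      x * (y * (b' * a' * p - p * (a' * b'))) := by
    have hyw : ∀ w, b' * a' * (y * w) * (a' * b') = y * (b' * a' * w * (a' * b')) := by
      intro w
      rw [← mul_assoc (b' * a') y w, hy (b' * a')]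
      simp only [mul_assoc]
    have hxw : ∀ w, b' * a' * (x * w) * (a' * b') = x * (b' * a' * w * (a' * b')) := by
      intro w
      rw [← mul_assoc (b' * a') x w, hx (b' * a')]
      simp only [mul_assoc]
    have h1 : b' * a' * (a * b) = 1 := by
      rw [mul_assoc, ← mul_assoc a' a b, ha'a, one_mul, hb'b]
    have h2 : b * a * (a' * b') = 1 := by
      rw [mul_assoc, ← mul_assoc a a' b', haa', one_mul, hbb']
    have h3 : b' * a' * (a * b - b * a) * (a' * b') = a' * b' - b' * a' := by
      rw [mul_sub, sub_mul, h1, one_mul, mul_assoc (b' * a') (b * a), h2, mul_one]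
    have h4 : b' * a' * (p * (b * a) - a * b * p) * (a' * b') =
        b' * a' * p - p * (a' * b') := by
      rw [mul_sub, sub_mul, ← mul_assoc (b' * a') (a * b) p, h1, one_mul,
        ← mul_assoc (b' * a') p, mul_assoc (b' * a' * p) (b * a), h2, mul_one]
    have := congrArg (fun w => b' * a' * w * (a' * b')) key
    simp only [mul_sub (b' * a') (y * _), sub_mul (b' * a' * (y * _)), hyw, hxw, h3, h4] at this
    exact this
  have := congrArg (fun w => PowerSeries.coeff (r + 1) (PowerSeries.coeff (s + 1) w)) key'
  simp only [x, y, p, a', b', PowerSeries.coeff_C_mul, PowerSeries.coeff_mul_C, map_sub,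
    PowerSeries.coeff_succ_X_mul, PowerSeries.coeff_map] at this
  exact this

/-- `x ↦ x ⊗ 1` on matrices. -/
def tensorLeft (n : ℕ) (A : Type*) [Ring A] :
    Matrix (Fin n) (Fin n) A →+* Matrix (Fin n × Fin n) (Fin n × Fin n) A where
  toFun x := Matrix.of fun p q => if p.2 = q.2 then x p.1 q.1 else 0
  map_one' := by
    ext p q
    by_cases h1 : p.1 = q.1 <;> by_cases h2 : p.2 = q.2 <;>
      simp [Matrix.one_apply, Prod.ext_iff, h1, h2]
  map_mul' x y := by
    ext p q
    by_cases h : p.2 = q.2 <;> simp [Matrix.mul_apply, Fintype.sum_prod_type, h]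
  map_zero' := by ext p q; simp
  map_add' x y := by
    ext p q
    by_cases h : p.2 = q.2 <;> simp [h]

/-- `x ↦ 1 ⊗ x` on matrices. -/
def tensorRight (n : ℕ) (A : Type*) [Ring A] :
    Matrix (Fin n) (Fin n) A →+* Matrix (Fin n × Fin n) (Fin n × Fin n) A where
  toFun x := Matrix.of fun p q => if p.1 = q.1 then x p.2 q.2 else 0
  map_one' := by
    ext p q
    by_cases h1 : p.1 = q.1 <;> by_cases h2 : p.2 = q.2 <;>
      simp [Matrix.one_apply, Prod.ext_iff, h1, h2]
  map_mul' x y := by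
    ext p q
    by_cases h : p.1 = q.1 <;> simp [Matrix.mul_apply, Fintype.sum_prod_type, h]
  map_zero' := by ext p q; simp
  map_add' x y := by
    ext p q
    by_cases h : p.1 = q.1 <;> simp [h]

/-- The permutation matrix `∑ E_ij ⊗ E_ji`. -/
def tensorSwap (n : ℕ) (A : Type*) [Ring A] : Matrix (Fin n × Fin n) (Fin n × Fin n) A :=
  Matrix.of fun p q => if p.1 = q.2 ∧ p.2 = q.1 then 1 else 0

section Tensor

variable {n : ℕ} {A : Type*} [Ring A] (x y : Matrix (Fin n) (Fin n) A)

theorem tensorLeft_mul_tensorRight (p q : Fin n × Fin n) :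
    (tensorLeft n A x * tensorRight n A y) p q = x p.1 q.1 * y p.2 q.2 := by
  simp [tensorLeft, tensorRight, Matrix.mul_apply, Fintype.sum_prod_type]

theorem tensorRight_mul_tensorLeft (p q : Fin n × Fin n) :
    (tensorRight n A y * tensorLeft n A x) p q = y p.2 q.2 * x p.1 q.1 := by
  simp [tensorLeft, tensorRight, Matrix.mul_apply, Fintype.sum_prod_type]

theorem tensorSwap_mul (w : Matrix (Fin n × Fin n) (Fin n × Fin n) A) (p q : Fin n × Fin n) :
    (tensorSwap n A * w) p q = w p.swap q := by
  simp [tensorSwap, Matrix.mul_apply, Fintype.sum_prod_type, ite_and, Prod.swap]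

theorem mul_tensorSwap (w : Matrix (Fin n × Fin n) (Fin n × Fin n) A) (p q : Fin n × Fin n) :
    (w * tensorSwap n A) p q = w p q.swap := by
  simp [tensorSwap, Matrix.mul_apply, Fintype.sum_prod_type, ite_and, Prod.swap]

end Tensor

theorem omegaFamily_isRTT {n : ℕ} {A : Type*} [Ring A] {t : Fin n → Fin n → ℕ → A}
    (ht : IsRTT t) : IsRTT (omegaFamily t) where
  zero i j := by
    have h : PowerSeries.coeff 0 (matTInv t) = 1 := by simp [matTInv]
    simp only [omegaFamily, h, pow_zero, one_mul, Matrix.one_apply]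
  rel i j k l r s := by
    have h1 := matT_mul_matTInv ht
    have h2 := matTInv_mul_matT ht
    have hc : ∀ r, PowerSeries.coeff r (matT t) = Matrix.of fun i j => t i j r := fun r => by
      rw [matT, PowerSeries.coeff_mk]
    have h0 : PowerSeries.coeff 0 (matT t) = 1 := by
      rw [PowerSeries.coeff_zero_eq_constantCoeff_apply, constantCoeff_matT ht, Units.val_one]
    have key := rtt_inverse (tensorSwap n A)
      (PowerSeries.map (tensorLeft n A) (matT t)) (PowerSeries.map (tensorRight n A) (matT t))
      (PowerSeries.map (tensorLeft n A) (matTInv t)) (PowerSeries.map (tensorRight n A) (matTInv t))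
      (by rw [← map_mul, h1, map_one]) (by rw [← map_mul, h2, map_one])
      (by rw [← map_mul, h1, map_one]) (by rw [← map_mul, h2, map_one])
      (by rw [PowerSeries.coeff_map, h0, map_one]) (by rw [PowerSeries.coeff_map, h0, map_one])
      (by
        intro r s
        ext p q
        simp only [PowerSeries.coeff_map, Matrix.sub_apply, tensorLeft_mul_tensorRight,
          tensorRight_mul_tensorLeft, tensorSwap_mul, mul_tensorSwap, hc, Matrix.of_apply,
          Prod.fst_swap, Prod.snd_swap]
        have := ht.rel p.2 q.2 p.1 q.1 s r
        rw [← sub_eq_zero] at this ⊢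
        rw [← this]
        abel) r s
    have key2 := congrFun (congrFun key (i, k)) (j, l)
    simp only [PowerSeries.coeff_map, Matrix.sub_apply, tensorLeft_mul_tensorRight,
      tensorRight_mul_tensorLeft, tensorSwap_mul, mul_tensorSwap,
      Prod.fst_swap, Prod.snd_swap] at key2
    have hs : ∀ (a b : ℕ) (X Y : A),
        ((-1) ^ a * X) * ((-1) ^ b * Y) = (-1) ^ (a + b) * (X * Y) := by
      intro a b X Y
      have hcomm : X * (-1) ^ b = (-1) ^ b * X := ((Commute.neg_one_left X).pow_left b).eq.symm
      rw [pow_add, mul_assoc, ← mul_assoc X, hcomm]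
      simp only [mul_assoc]
    simp only [omegaFamily, hs]
    rw [show s + (r + 1) = r + s + 1 by omega, show r + 1 + s = r + s + 1 by omega,
      show r + (s + 1) = r + s + 1 by omega, show s + 1 + r = r + s + 1 by omega,
      add_comm s r]
    simp only [← mul_sub]
    rw [key2, pow_succ, mul_assoc]
    congr 1
    rw [neg_one_mul, neg_sub]

/-- The automorphism `ω_n` of `Y(gl_n)`, `t_ij^{(k)} ↦ (-1)^k t'_ij^{(k)}`. -/
def omega (n : ℕ) : Yangian n →ₐ[ℂ] Yangian n :=
  Yangian.lift (omegaFamily Yangian.t) (omegaFamily_isRTT (Yangian.isRTT n))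

/-! ### The maps `i_n`, `j_m`, `φ_n`, `ψ_m` -/

/-- `i_n : Y(gl_n) → Y(gl_{n+m})`, `t_ij(u) ↦ t_ij(u)`. -/
def iota (n m : ℕ) : Yangian n →ₐ[ℂ] Yangian (n + m) :=
  Yangian.lift (fun i j r => Yangian.t (Fin.castAdd m i) (Fin.castAdd m j) r)
    { zero := fun i j => by simp [(Yangian.isRTT (n + m)).zero]
      rel := fun _ _ _ _ _ _ => (Yangian.isRTT (n + m)).rel _ _ _ _ _ _ }

/-- `j_m : Y(gl_m) → Y(gl_{n+m})`, `t_ij(u) ↦ t_{n+i,n+j}(u)`. -/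
def jota (n m : ℕ) : Yangian m →ₐ[ℂ] Yangian (n + m) :=
  Yangian.lift (fun i j r => Yangian.t (Fin.natAdd n i) (Fin.natAdd n j) r)
    { zero := fun i j => by simp [(Yangian.isRTT (n + m)).zero]
      rel := fun _ _ _ _ _ _ => (Yangian.isRTT (n + m)).rel _ _ _ _ _ _ }

/-- `φ_n = ω_{n+m} ∘ i_n ∘ ω_n`. -/
def phi (n m : ℕ) : Yangian n →ₐ[ℂ] Yangian (n + m) :=
  (omega (n + m)).comp ((iota n m).comp (omega n))

/-- `ψ_m = ω_{n+m} ∘ j_m ∘ ω_m`. -/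
def psi (n m : ℕ) : Yangian m →ₐ[ℂ] Yangian (n + m) :=
  (omega (n + m)).comp ((jota n m).comp (omega m))

/-! ### The evaluation homomorphism -/

/-- The universal enveloping algebra `U(gl_N)`. -/
abbrev Ugl (N : ℕ) : Type := UniversalEnvelopingAlgebra ℂ (Matrix (Fin N) (Fin N) ℂ)

/-- The generator `e_ij` of `U(gl_N)`, the image of the matrix unit `E_ij`. -/
def e {N : ℕ} (i j : Fin N) : Ugl N :=
  UniversalEnvelopingAlgebra.ι ℂ (Matrix.single i j (1 : ℂ))

/-- The coefficients of `δ_ij + e_ij u^{-1}`. -/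
def evFamily (N : ℕ) (i j : Fin N) : ℕ → Ugl N
  | 0 => if i = j then 1 else 0
  | 1 => e i j
  | _ + 2 => 0

theorem e_commutator {N : ℕ} (i j k l : Fin N) :
    e i j * e k l - e k l * e i j =
      (if k = j then e i l else 0) - (if i = l then e k j else 0) := by
  have h := (UniversalEnvelopingAlgebra.ι ℂ).map_lie
    (Matrix.single i j (1 : ℂ)) (Matrix.single k l (1 : ℂ))
  rw [LieRing.of_associative_ring_bracket, LieRing.of_associative_ring_bracket] at h
  unfold e
  rw [← h, map_sub]
  congr 1
  · by_cases hk : k = j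
    · subst hk; simp
    · rw [Matrix.single_mul_single_of_ne _ _ _ _ (Ne.symm hk)]; simp [hk]
  · by_cases hi : i = l
    · subst hi; simp
    · rw [Matrix.single_mul_single_of_ne _ _ _ _ (Ne.symm hi)]; simp [hi]

theorem evFamily_isRTT (N : ℕ) : IsRTT (evFamily N) where
  zero _ _ := rfl
  rel i j k l r s := by
    have h := e_commutator i j k l
    rcases r with _ | _ | r <;> rcases s with _ | _ | s <;> simp [evFamily]
    · exact h
    · rw [← neg_sub, h, neg_sub]

/-- The evaluation homomorphism `ev_N : Y(gl_N) → U(gl_N)`, `t_ij(u) ↦ δ_ij + e_ij u^{-1}`. -/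
def ev (N : ℕ) : Yangian N →ₐ[ℂ] Ugl N :=
  Yangian.lift (evFamily N) (evFamily_isRTT N)

/-! ### Difference operators

Elements of `A⸨X⸩` are Laurent series in `X = u^{-1}`. -/

section Difference

variable {A : Type*} [Ring A] [Algebra ℂ A]

/-- The coefficient of `u^{-r}` in `f(u + c)`. It is obtained by expanding
`(u + c)^{-k} = ∑_{p ≥ 0} binom(-k, p) c^p u^{-k-p}` in every term `a_k (u + c)^{-k}`, and taking
the terms with `k + p = r`; almost all summands vanish since `a_{r-p} = 0` for large `p`. -/
def shiftCoeff (c : ℂ) (f : A⸨X⸩) (r : ℤ) : A :=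
  ∑ᶠ p : ℕ, (((Ring.choose (-(r - (p : ℤ))) p : ℤ) : ℂ) * c ^ p) • f.coeff (r - (p : ℤ))

theorem shiftCoeff_finite (c : ℂ) (f : A⸨X⸩) (r : ℤ) :
    (Function.support fun p : ℕ =>
      (((Ring.choose (-(r - (p : ℤ))) p : ℤ) : ℂ) * c ^ p) • f.coeff (r - (p : ℤ))).Finite := by
  refine (Set.finite_le_nat (r - f.order).toNat).subset fun p hp => ?_
  by_contra hlt
  refine hp ?_
  simp only [Set.mem_ofPred_eq, not_le] at hlt
  simp only []
  rw [HahnSeries.coeff_eq_zero_of_lt_order (by omega), smul_zero]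

theorem shiftCoeff_bddBelow (c : ℂ) (f : A⸨X⸩) :
    BddBelow (Function.support (shiftCoeff c f)) := by
  refine ⟨f.order, fun r hr => ?_⟩
  by_contra hlt
  refine hr (finsum_eq_zero_of_forall_eq_zero fun p => ?_)
  rw [HahnSeries.coeff_eq_zero_of_lt_order (by omega), smul_zero]

/-- The shift `f(u) ↦ f(u + c)` on Laurent series in `u^{-1}`. -/
def shift (c : ℂ) : Module.End ℂ A⸨X⸩ where
  toFun f := HahnSeries.ofSuppBddBelow (shiftCoeff c f) (shiftCoeff_bddBelow c f)
  map_add' f g := by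
    ext r
    change shiftCoeff c (f + g) r = shiftCoeff c f r + shiftCoeff c g r
    simp only [HahnSeries.coeff_add, shiftCoeff, smul_add]
    exact finsum_add_distrib (shiftCoeff_finite c f r) (shiftCoeff_finite c g r)
  map_smul' a f := by
    ext r
    change shiftCoeff c (a • f) r = a • shiftCoeff c f r
    simp only [HahnSeries.coeff_smul, shiftCoeff]
    rw [smul_finsum' a (shiftCoeff_finite c f r)]
    exact finsum_congr fun p => smul_comm _ _ _

/-- A Laurent series, regarded as the operator of left multiplication by it. -/
def mulOp (f : A⸨X⸩) : Module.End ℂ A⸨X⸩ := LinearMap.mulLeft ℂ f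

/-- The shift operator `τ`, `(τ f)(u) = f(u + 1)`. -/
def tau : Module.End ℂ A⸨X⸩ := shift 1

/-- The series `∑_{j ≥ 0} a_j u^{-j}`. -/
def series (a : ℕ → A) : A⸨X⸩ := HahnSeries.ofPowerSeries ℤ A (PowerSeries.mk a)

end Difference

/-! ### Bethe subalgebras -/

/-- `D_ij = c_i δ_ij τ - t_ij(u - j + 1)`, for 1-based `j`. -/
def opD {n : ℕ} (C : Fin n → ℂ) (i j : Fin n) : Module.End ℂ (Yangian n)⸨X⸩ :=
  (if i = j then C i • tau else 0) - mulOp (shift (-((j : ℕ) : ℂ)) (series (Yangian.t i j)))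

/-- `D_n(C) = ∑_σ (-1)^σ D_{σ(1),1} D_{σ(2),2} ⋯ D_{σ(n),n}`, the product being taken from left to
right. -/
def diffOp {n : ℕ} (C : Fin n → ℂ) : Module.End ℂ (Yangian n)⸨X⸩ :=
  ∑ σ : Equiv.Perm (Fin n),
    (Equiv.Perm.sign σ : ℤ) • (List.ofFn fun j : Fin n => opD C (σ j) j).prod

/-- `B` is the family of coefficients of `D_n(C)`:
`D_n(C) = ∑_{i=0}^n (-1)^i (∑_{j≥0} B_ij u^{-j}) τ^{n-i}`. There is exactly one such family:
it exists since `τ f(u) = f(u + 1) τ`, and operators `∑ f_i(u) τ^i` determine their `f_i(u)`. -/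
def IsBetheCoeff {n : ℕ} (C : Fin n → ℂ) (B : Fin (n + 1) → ℕ → Yangian n) : Prop :=
  diffOp C = ∑ i : Fin (n + 1), (-1 : ℤ) ^ (i : ℕ) • (mulOp (series (B i)) * tau ^ (n - (i : ℕ)))

/-- The Bethe subalgebra `B_n(C)` of `Y(gl_n)`, generated by the coefficients of `D_n(C)`. -/
def betheAlgebra {n : ℕ} (C : Fin n → ℂ) : Subalgebra ℂ (Yangian n) :=
  Algebra.adjoin ℂ {x | ∃ B, IsBetheCoeff C B ∧ ∃ i j, x = B i j}

end BetheDuality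

end

noncomputable section

namespace BetheDuality

/-! ### Column determinants over a noncommutative ring -/

/-! Let N = n + m, let M = (1 + E u⁻¹) τ⁻¹ be the matrix `capelli N` over U(gl_N), and let P_{a,b}
(`typedMinorSum`) be the sum of the principal minors of M with a rows among the first n indices and
b among the last m. Both sides of the equality turn out to be generated by the center and the
coefficients of all the P_{a,b}, a description in which the two blocks play the same role.

Up to a power of τ, the Bethe operator is the column determinant of 1 - T(u) τ⁻¹ (`diffOp_eq`).
Separating powers of τ, the image of the Bethe subalgebra under a homomorphism is generated by the
coefficients of the sums of principal minors of the image of T(u) τ⁻¹ (`map_betheAlgebra_le_iff`).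
Conjugating a block embedding by ω means: invert T, take a block, invert back. Hence ev ∘ φ_n sends
T(u) to the Schur complement A - B D⁻¹ C of 1 + E u⁻¹ (`isSchurComplement_conj`).

The matrix M is a Manin matrix (`capelli_isManin`), and Manin matrices satisfy the Schur complement
formula for column determinants (`IsManin.cdet_schur`, proved with Grassmann variables). Applied to
J - M, where J is the identity on the first block and zero on the second, it gives P_{k,m} = P_{0,m}
Q_k with Q_k the sum of the k × k principal minors of the Schur complement
(`IsSchurComplement.typedMinorSum_eq`).

Two facts turn this into a symmetric description. First, P_{n,m} = cdet M has central coefficients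
(`cdet_capelli_isHomog_center`); since Q_n is invertible, P_{0,m}, and then every P_{k,m}, has
coefficients in the algebra generated by the center and the Q_k. Second, the commutator with τ u
sends M to the identity matrix, so that [τ u, P_{a,b+1}] = (m - b) P_{a,b} + (n - a + 1)
P_{a-1,b+1}, with no second term for a = 0. As τ u has scalar coefficients, descending induction on
b yields all P_{a,b} (`typedMinorSum_isHomog_of_top`). Among them are the P_{n,b}, and P_{n,0}⁻¹
P_{n,b} gives the generators of the image under ψ_m. Exchanging the blocks gives the other
inclusion. -/

/-- The column determinant: factors are multiplied in the order of their columns. -/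
def cdet {k : ℕ} {R : Type*} [Ring R] (M : Matrix (Fin k) (Fin k) R) : R :=
  ∑ σ : Equiv.Perm (Fin k), (Equiv.Perm.sign σ : ℤ) • (List.ofFn fun j => M (σ j) j).prod

/-- The commutation relations of a Manin matrix. -/
def IsManin {ι κ R : Type*} [Ring R] (M : Matrix ι κ R) : Prop :=
  ∀ i j k l, M i j * M k l - M k l * M i j = M k j * M i l - M i l * M k j

/-! ### Anticommuting families and the exterior algebra -/

section Grassmann

variable {G : Type*} [Ring G] [Algebra ℂ G]

/-- Anticommutation makes the square of every linear combination equal to its own negative, hence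
zero over ℂ. All sign rules for products of the x i are then inherited from the alternating map
`ExteriorAlgebra.ιMulti`. -/
theorem exists_exteriorAlgebra_hom {ι : Type*} [Fintype ι] [DecidableEq ι] (x : ι → G)
    (hx : ∀ i j, x i * x j = -(x j * x i)) :
    ∃ F : ExteriorAlgebra ℂ (ι → ℂ) →ₐ[ℂ] G,
      ∀ i, F (ExteriorAlgebra.ι ℂ (Pi.single i 1)) = x i := by
  refine ⟨ExteriorAlgebra.lift ℂ ⟨Fintype.linearCombination ℂ x, fun v => ?_⟩, fun i => ?_⟩
  · have h : (∑ i, v i • x i) * (∑ i, v i • x i) = -((∑ i, v i • x i) * (∑ i, v i • x i)) := by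
      rw [Finset.sum_mul_sum]
      conv_lhs => rw [Finset.sum_comm]
      rw [← Finset.sum_neg_distrib]
      refine Finset.sum_congr rfl fun i _ => ?_
      rw [← Finset.sum_neg_distrib]
      refine Finset.sum_congr rfl fun j _ => ?_
      rw [smul_mul_smul_comm, smul_mul_smul_comm, hx j i, smul_neg, mul_comm]
    have h2 : (2 : ℂ) • ((∑ i, v i • x i) * (∑ i, v i • x i)) = 0 := by
      rw [two_smul]
      nth_rewrite 1 [h]
      exact neg_add_cancel _
    rw [Fintype.linearCombination_apply]
    exact (smul_eq_zero.mp h2).resolve_left two_ne_zero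
  · rw [ExteriorAlgebra.lift_ι_apply, Fintype.linearCombination_apply_single, one_smul]

theorem prod_comp_eq_ιMulti {ι : Type*} [DecidableEq ι] {l : ℕ} {x : ι → G}
    {F : ExteriorAlgebra ℂ (ι → ℂ) →ₐ[ℂ] G}
    (hF : ∀ i, F (ExteriorAlgebra.ι ℂ (Pi.single i 1)) = x i) (f : Fin l → ι) :
    (List.ofFn fun j => x (f j)).prod =
      F (ExteriorAlgebra.ιMulti ℂ l fun j => Pi.single (f j) (1 : ℂ)) := by
  rw [ExteriorAlgebra.ιMulti_apply, map_list_prod, List.map_ofFn]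
  congr 2
  funext j
  exact (hF (f j)).symm

theorem prod_eq_zero_of_not_injective {ι : Type*} [Fintype ι] [DecidableEq ι] {l : ℕ} {x : ι → G}
    (hx : ∀ i j, x i * x j = -(x j * x i)) {f : Fin l → ι} (hf : ¬Function.Injective f) :
    (List.ofFn fun j => x (f j)).prod = 0 := by
  obtain ⟨F, hF⟩ := exists_exteriorAlgebra_hom x hx
  rw [prod_comp_eq_ιMulti hF, ExteriorAlgebra.ιMulti_eq_zero_of_not_inj, map_zero]
  exact fun h => hf fun a b hab => h (by simp [hab])

theorem prod_perm {k : ℕ} {x : Fin k → G}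
    (hx : ∀ i j, x i * x j = -(x j * x i)) (σ : Equiv.Perm (Fin k)) :
    (List.ofFn fun j => x (σ j)).prod = (Equiv.Perm.sign σ : ℤ) • (List.ofFn x).prod := by
  obtain ⟨F, hF⟩ := exists_exteriorAlgebra_hom x hx
  have h1 := prod_comp_eq_ιMulti hF (fun j => σ j)
  have h2 := prod_comp_eq_ιMulti hF (fun j => j)
  rw [h1, h2, ← map_zsmul]
  congr 1
  exact AlternatingMap.map_perm (ExteriorAlgebra.ιMulti ℂ k) (fun j => Pi.single j (1 : ℂ)) σ

theorem prod_mul_of_commute {R : Type*} [Ring R] (r : R →+* G) {k : ℕ} (a : Fin k → G)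
    (b : Fin k → R) (h : ∀ j x, r x * a j = a j * r x) :
    (List.ofFn fun j => a j * r (b j)).prod = (List.ofFn a).prod * r (List.ofFn b).prod := by
  induction k with
  | zero => simp
  | succ k ih =>
    have hc : ∀ x, r x * (List.ofFn fun j : Fin k => a j.succ).prod =
        (List.ofFn fun j : Fin k => a j.succ).prod * r x := by
      intro x
      refine Commute.list_prod_right _ _ fun y hy => ?_
      obtain ⟨j, rfl⟩ := List.mem_ofFn.mp hy
      exact h _ x
    simp only [List.ofFn_succ, List.prod_cons, map_mul]
    rw [ih (fun j => a j.succ) (fun j => b j.succ) fun j => h j.succ]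
    simp only [mul_assoc]
    rw [← mul_assoc (r (b 0)), hc, mul_assoc]

theorem prod_sum_expand {ι : Type*} [Fintype ι] [DecidableEq ι] {k : ℕ} (v : Fin k → ι → G) :
    (List.ofFn fun j => ∑ i, v j i).prod =
      ∑ f : Fin k → ι, (List.ofFn fun j => v j (f j)).prod := by
  have := MultilinearMap.map_sum (MultilinearMap.mkPiAlgebraFin ℂ k G) v
  simpa only [MultilinearMap.mkPiAlgebraFin_apply] using this

/-- The product of the Grassmann linear forms of the columns is the column determinant. -/
theorem prod_columns {R : Type*} [Ring R] (r : R →+* G) {k : ℕ} {x : Fin k → G}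
    (hx : ∀ i j, x i * x j = -(x j * x i)) (hr : ∀ i y, r y * x i = x i * r y)
    (M : Matrix (Fin k) (Fin k) R) :
    (List.ofFn fun j => ∑ i, x i * r (M i j)).prod = (List.ofFn x).prod * r (cdet M) := by
  rw [prod_sum_expand fun j i => x i * r (M i j)]
  have h1 : ∀ f : Fin k → Fin k, (List.ofFn fun j => x (f j) * r (M (f j) j)).prod =
      (List.ofFn fun j => x (f j)).prod * r (List.ofFn fun j => M (f j) j).prod := fun f =>
    prod_mul_of_commute r _ (fun j => M (f j) j) fun j y => hr _ y
  simp only [h1]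
  rw [cdet, map_sum, Finset.mul_sum]
  symm
  -- Only injective choices of rows contribute, and an injective self-map of a finite set is a
  -- permutation.
  refine Finset.sum_of_injOn (fun σ : Equiv.Perm (Fin k) => (σ : Fin k → Fin k))
    (fun a _ b _ h => DFunLike.coe_injective h) (fun _ _ => Finset.mem_univ _) ?_ ?_
  · intro f _ hf
    rw [prod_eq_zero_of_not_injective hx, zero_mul]
    intro hinj
    exact hf ⟨Equiv.ofBijective f (Finite.injective_iff_bijective.mp hinj), by simp, by ext; simp⟩
  · intro σ _
    rw [prod_perm hx, map_zsmul, mul_smul_comm, smul_mul_assoc]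

end Grassmann

/-! ### Grassmann variables with noncommutative coefficients -/

section GrassmannExtension

open TensorProduct

variable (R : Type*) [Ring R] [Algebra ℂ R]

/-- The Grassmann algebra on `ι` generators with coefficients in `R`. -/
abbrev GrassExt (ι : Type*) : Type _ := R ⊗[ℂ] ExteriorAlgebra ℂ (ι → ℂ)

variable {R} {ι : Type*} [Fintype ι] [DecidableEq ι]

/-- The generators of the Grassmann algebra. -/
def grassGen (R : Type*) [Ring R] [Algebra ℂ R] (i : ι) : GrassExt R ι :=
  Algebra.TensorProduct.includeRight (ExteriorAlgebra.ι ℂ (Pi.single i (1 : ℂ)))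

/-- The coefficients of the Grassmann algebra. -/
def grassCoeff (R : Type*) [Ring R] [Algebra ℂ R] (ι : Type*) : R →+* GrassExt R ι :=
  (Algebra.TensorProduct.includeLeft : R →ₐ[ℂ] GrassExt R ι).toRingHom

theorem grassCoeff_comm (y : R) (i : ι) :
    grassCoeff R ι y * grassGen R i = grassGen R i * grassCoeff R ι y := by
  simp [grassCoeff, grassGen]

theorem grassGen_anticomm (i j : ι) :
    grassGen R i * grassGen R j = -(grassGen R j * grassGen R i) := by
  unfold grassGen
  rw [← map_mul Algebra.TensorProduct.includeRight, ← map_mul Algebra.TensorProduct.includeRight,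
    ← map_neg Algebra.TensorProduct.includeRight]
  congr 1
  exact eq_neg_of_add_eq_zero_left (ExteriorAlgebra.ι_add_mul_swap _ _)

/-- The determinant, extended by zero to the other degrees of the exterior algebra, is a functional
with value 1 on the top product; applied to the second tensor factor it recovers the coefficient.
This is how identities between products of linear forms become identities between column
determinants. -/
theorem grassTop_mul_injective {k : ℕ} (s : Fin k ≃ ι) {y z : R}
    (h : (List.ofFn fun j => grassGen R (s j)).prod * grassCoeff R ι y =
      (List.ofFn fun j => grassGen R (s j)).prod * grassCoeff R ι z) : y = z := by
  let b : Module.Basis (Fin k) ℂ (ι → ℂ) := (Pi.basisFun ℂ ι).reindex s.symm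
  let F : ExteriorAlgebra ℂ (ι → ℂ) →ₗ[ℂ] ℂ :=
    ExteriorAlgebra.liftAlternating (R := ℂ) (Pi.single k b.det)
  let Φ : GrassExt R ι →ₗ[ℂ] R :=
    (TensorProduct.rid ℂ R).toLinearMap ∘ₗ LinearMap.lTensor R F
  have key : ∀ y : R, Φ ((List.ofFn fun j => grassGen R (s j)).prod * grassCoeff R ι y) = y := by
    intro y
    have h1 : (List.ofFn fun j => grassGen R (s j)).prod =
        Algebra.TensorProduct.includeRight (ExteriorAlgebra.ιMulti ℂ k fun j =>
          Pi.single (s j) (1 : ℂ)) := by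
      rw [ExteriorAlgebra.ιMulti_apply, map_list_prod, List.map_ofFn]
      rfl
    have h2 : (fun j => Pi.single (s j) (1 : ℂ)) = b := by
      funext j
      simp [b]
    have h3 : F (ExteriorAlgebra.ιMulti ℂ k b) = 1 := by
      simp only [F]
      rw [ExteriorAlgebra.liftAlternating_apply_ιMulti, Pi.single_eq_same, b.det_self]
    rw [h1, h2]
    simp [grassCoeff, Φ, h3]
  rw [← key y, h, key]

/-- The Grassmann linear form of a column. -/
def grassCol (M : Matrix ι ι R) (j : ι) : GrassExt R ι :=
  ∑ i, grassGen R i * grassCoeff R ι (M i j)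

/-- The Manin relations say that M i j * M k l + M i l * M k j is symmetric in i and k, whereas the
product of the generators i and k is antisymmetric. The sum of the two products of column forms is
therefore its own negative. -/
theorem grassCol_anticomm {M : Matrix ι ι R} (hM : IsManin M) (j l : ι) :
    grassCol M j * grassCol M l = -(grassCol M l * grassCol M j) := by
  have hmul : ∀ j l, grassCol M j * grassCol M l =
      ∑ i, ∑ k, grassGen R i * grassGen R k * grassCoeff R ι (M i j * M k l) := by
    intro j l
    rw [grassCol, grassCol, Finset.sum_mul_sum]
    refine Finset.sum_congr rfl fun i _ => Finset.sum_congr rfl fun k _ => ?_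
    rw [map_mul, mul_assoc, ← mul_assoc (grassCoeff R ι (M i j)), grassCoeff_comm]
    simp only [mul_assoc]
  have hswap : ∀ f : ι → ι → R,
      ∑ i, ∑ k, grassGen R i * grassGen R k * grassCoeff R ι (f i k) =
        -∑ i, ∑ k, grassGen R i * grassGen R k * grassCoeff R ι (f k i) := by
    intro f
    rw [Finset.sum_comm, ← Finset.sum_neg_distrib]
    refine Finset.sum_congr rfl fun i _ => ?_
    rw [← Finset.sum_neg_distrib]
    refine Finset.sum_congr rfl fun k _ => ?_
    rw [grassGen_anticomm, neg_mul]
  rw [← sub_eq_zero, sub_neg_eq_add, hmul, hmul, ← Finset.sum_add_distrib]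
  simp only [← Finset.sum_add_distrib, ← mul_add, ← map_add]
  set S := ∑ i, ∑ k, grassGen R i * grassGen R k *
    grassCoeff R ι (M i j * M k l + M i l * M k j) with hS
  have h1 : S = -S := by
    rw [hS]
    nth_rewrite 1 [hswap]
    congr 1
    refine Finset.sum_congr rfl fun i _ => Finset.sum_congr rfl fun k _ => ?_
    congr 2
    have := hM i j k l
    rw [sub_eq_sub_iff_add_eq_add] at this
    rw [add_comm (M i j * M k l), ← sub_eq_zero]
    rw [← sub_eq_zero] at this
    rw [← neg_eq_zero, ← this]
    abel
  have h2 : (2 : ℂ) • S = 0 := by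
    rw [two_smul]
    nth_rewrite 1 [h1]
    exact neg_add_cancel _
  exact (smul_eq_zero.mp h2).resolve_left two_ne_zero

end GrassmannExtension

/-! ### Column determinants of Manin matrices and the Schur complement formula -/

section ColumnDeterminant

variable {R : Type*} [Ring R] [Algebra ℂ R]

theorem prod_grassCol_comp {k : ℕ} {ι : Type*} [Fintype ι] [DecidableEq ι] (s : Fin k ≃ ι)
    (M : Matrix ι ι R) (f : Fin k → ι) :
    (List.ofFn fun j => grassCol M (f j)).prod =
      (List.ofFn fun j => grassGen R (s j)).prod *
        grassCoeff R ι (cdet (Matrix.of fun i j => M (s i) (f j))) := by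
  rw [← prod_columns (grassCoeff R ι) (x := fun j => grassGen R (s j))
    (fun i j => grassGen_anticomm _ _) (fun i y => grassCoeff_comm _ _)]
  congr 2
  funext j
  rw [grassCol, ← Equiv.sum_comp s]
  rfl

theorem IsManin.submatrix {ι κ ι' κ' : Type*} {M : Matrix ι κ R} (hM : IsManin M) (f : ι' → ι)
    (g : κ' → κ) : IsManin (M.submatrix f g) := fun _ _ _ _ => hM _ _ _ _

/-- Permuting columns produces the sign by anticommutation of the column forms, permuting rows
produces the same sign by anticommutation of the generators, and the two cancel. Without the Manin
property the column order would matter. -/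
theorem IsManin.cdet_perm {k : ℕ} {M : Matrix (Fin k) (Fin k) R} (hM : IsManin M)
    (s : Equiv.Perm (Fin k)) : cdet (M.submatrix s s) = cdet M := by
  have h1 := prod_grassCol_comp s M s
  have h2 := prod_grassCol_comp (Equiv.refl _) M id
  simp only [id, Equiv.refl_apply] at h2
  rw [prod_perm (fun i j => grassCol_anticomm hM i j) s, h2,
    prod_perm (fun i j => grassGen_anticomm i j) s, ← smul_mul_assoc] at h1
  rw [smul_mul_assoc, smul_mul_assoc] at h1
  have hs : ((Equiv.Perm.sign s : ℤ) * (Equiv.Perm.sign s : ℤ)) = 1 := by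
    rw [← Units.val_mul, Int.units_mul_self, Units.val_one]
  have h3 := congrArg (fun z => (Equiv.Perm.sign s : ℤ) • z) h1
  simp only [smul_smul, hs, one_smul] at h3
  exact (grassTop_mul_injective (Equiv.refl _) h3).symm

theorem IsManin.cdet_submatrix_equiv {k l : ℕ} {M : Matrix (Fin k) (Fin k) R} (hM : IsManin M)
    (s : Fin l ≃ Fin k) : cdet (M.submatrix s s) = cdet M := by
  obtain rfl : l = k := by simpa using Fintype.card_congr s
  exact hM.cdet_perm s

theorem IsManin.cdet_column_eq_zero {k : ℕ} {M : Matrix (Fin k) (Fin k) R} (hM : IsManin M)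
    {f : Fin k → Fin k} (hf : ¬Function.Injective f) :
    cdet (Matrix.of fun i j => M i (f j)) = 0 := by
  have h := prod_grassCol_comp (Equiv.refl _) M f
  rw [prod_eq_zero_of_not_injective (fun i j => grassCol_anticomm hM i j) hf] at h
  refine (grassTop_mul_injective (Equiv.refl (Fin k)) ?_)
  rw [map_zero, mul_zero]
  exact h.symm

theorem prod_mul_self_eq_zero {G : Type*} [Ring G] [Algebra ℂ G] {k : ℕ} {x : Fin k → G}
    (hx : ∀ i j, x i * x j = -(x j * x i)) (j : Fin k) : (List.ofFn x).prod * x j = 0 := by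
  have h := prod_eq_zero_of_not_injective hx (l := k + 1) (f := Fin.snoc id j) (fun h => by
    have := @h (Fin.last k) j.castSucc (by simp)
    exact absurd this (Fin.castSucc_lt_last j).ne')
  rw [List.ofFn_succ_last] at h
  simpa using h

/-- Modulo a left annihilated anticommuting family, factors may be changed one by one. -/
theorem prod_replace_right {G ι : Type*} [Ring G] {n : ℕ} (Ψ : G) (y : ι → G)
    (x z : Fin n → G) (hΨ : ∀ j, Ψ * y j = 0) (hanti : ∀ i j, x i * y j = -(y j * x i))
    (hz : ∀ i, ∃ c : ι →₀ G, x i = z i + c.sum fun j g => y j * g) :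
    Ψ * (List.ofFn x).prod = Ψ * (List.ofFn z).prod := by
  induction n generalizing Ψ with
  | zero => simp
  | succ n ih =>
    obtain ⟨c, hc⟩ := hz 0
    have h0 : Ψ * x 0 = Ψ * z 0 := by
      rw [hc, mul_add, Finsupp.sum, Finset.mul_sum, Finset.sum_eq_zero, add_zero]
      intro j _
      rw [← mul_assoc, hΨ, zero_mul]
    simp only [List.ofFn_succ, List.prod_cons, ← mul_assoc]
    rw [ih (Ψ * x 0) (fun i => x i.succ) (fun i => z i.succ) _ (fun i j => hanti _ _)
      (fun i => hz _), h0]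
    intro j
    rw [mul_assoc, hanti, mul_neg, ← mul_assoc, hΨ, zero_mul, neg_zero]

/-- The mirror statement for terms absorbed on the right. -/
theorem prod_absorb_left {G : Type*} [Ring G] {m : ℕ} (Ξ : G) (x y : Fin m → G)
    (p : G → Prop) (hy : ∀ i, p (y i)) (hp : ∀ g, p g → g * Ξ = 0)
    (hxp : ∀ g i, p g → p (g * x i)) :
    (List.ofFn fun j => x j + y j).prod * Ξ = (List.ofFn x).prod * Ξ := by
  have hkill : ∀ (m : ℕ) (f : Fin m → G), (∀ g i, p g → p (g * f i)) →
      ∀ g, p g → g * (List.ofFn f).prod * Ξ = 0 := by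
    intro m
    induction m with
    | zero => intro f _ g hg; simpa using hp g hg
    | succ m ih =>
      intro f hf g hg
      rw [List.ofFn_succ, List.prod_cons, ← mul_assoc]
      exact ih _ (fun g i => hf g i.succ) _ (hf g 0 hg)
  induction m with
  | zero => simp
  | succ m ih =>
    simp only [List.ofFn_succ, List.prod_cons]
    rw [mul_assoc, ih (fun j => x j.succ) (fun j => y j.succ) (fun i => hy _)
      (fun g i => hxp g _), add_mul, ← mul_assoc (y 0),
      hkill m _ (fun g i => hxp g i.succ) _ (hy 0), add_zero, mul_assoc]

/-- The Schur complement formula for the column determinant of a Manin matrix, in the form that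
does not require the first block to be invertible. -/
theorem IsManin.cdet_schur {m n : ℕ} {M : Matrix (Fin m ⊕ Fin n) (Fin m ⊕ Fin n) R}
    (hM : IsManin M) (K : Matrix (Fin m) (Fin n) R) (S : Matrix (Fin n) (Fin n) R)
    (hK : ∀ i j, M (.inl i) (.inr j) = ∑ k, M (.inl i) (.inl k) * K k j)
    (hS : ∀ i j, M (.inr i) (.inr j) = S i j + ∑ k, M (.inr i) (.inl k) * K k j) :
    cdet (M.submatrix finSumFinEquiv.symm finSumFinEquiv.symm) =
      cdet (Matrix.of fun i j => M (.inl i) (.inl j)) * cdet S := by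
  set r := grassCoeff R (Fin m ⊕ Fin n)
  set ξ : Fin m ⊕ Fin n → GrassExt R (Fin m ⊕ Fin n) := grassGen R with hξ
  have hξa : ∀ i j, ξ i * ξ j = -(ξ j * ξ i) := grassGen_anticomm
  have hψa := grassCol_anticomm hM
  have hsplit : ∀ f : Fin m ⊕ Fin n → GrassExt R (Fin m ⊕ Fin n),
      (List.ofFn fun j : Fin (m + n) => f (finSumFinEquiv.symm j)).prod =
        (List.ofFn fun j => f (.inl j)).prod * (List.ofFn fun j => f (.inr j)).prod := by
    intro f
    have h : (fun j : Fin (m + n) => f (finSumFinEquiv.symm j)) =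
        Fin.append (fun j => f (.inl j)) (fun j => f (.inr j)) := by
      funext j
      refine Fin.addCases (fun i => ?_) (fun i => ?_) j <;> simp
    rw [h, List.ofFn_fin_append, List.prod_append]
  have h1 := prod_grassCol_comp finSumFinEquiv.symm M finSumFinEquiv.symm
  rw [hsplit (grassCol M)] at h1
  -- By `hK` and `hS`, a column form of the second block is the form of the corresponding column of
  -- S plus right multiples of column forms of the first block. The latter are annihilated by the
  -- product on the left.
  have h2 : (List.ofFn fun j => grassCol M (.inl j)).prod *
      (List.ofFn fun j => grassCol M (.inr j)).prod =
      (List.ofFn fun j => grassCol M (.inl j)).prod *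
      (List.ofFn fun j => ∑ i, ξ (.inr i) * r (S i j)).prod := by
    refine prod_replace_right _ (fun j : Fin m => grassCol M (.inl j)) _ _
      (fun j => prod_mul_self_eq_zero (fun i j => hψa _ _) j) (fun i j => hψa _ _) fun j => ?_
    refine ⟨Finsupp.equivFunOnFinite.symm fun k => r (K k j), ?_⟩
    rw [Finsupp.sum_fintype _ _ (by simp)]
    simp only [Finsupp.equivFunOnFinite_symm_apply_apply, grassCol, Fintype.sum_sum_type, hK, hS,
      map_add, map_sum, map_mul, mul_add, Finset.mul_sum, Finset.sum_mul, add_mul,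
      Finset.sum_add_distrib, mul_assoc]
    rw [Finset.sum_comm (s := Finset.univ (α := Fin m)) (t := Finset.univ (α := Fin m)),
      Finset.sum_comm (s := Finset.univ (α := Fin n)) (t := Finset.univ (α := Fin m))]
    abel
  have h3 := prod_columns r (x := fun i : Fin n => ξ (.inr i)) (fun i j => hξa _ _)
    (fun i y => grassCoeff_comm _ _) S
  -- Conversely, the product of all generators of the second block on the right absorbs the part of
  -- the first columns lying in these generators, also after they are moved past the remaining
  -- factors.
  have h4 : (List.ofFn fun j => grassCol M (.inl j)).prod * (List.ofFn fun j => ξ (.inr j)).prod =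
      (List.ofFn fun j => ∑ i, ξ (.inl i) * r (M (.inl i) (.inl j))).prod *
        (List.ofFn fun j => ξ (.inr j)).prod := by
    have hc : (fun j => grassCol M (.inl j)) = fun j =>
        (∑ i, ξ (.inl i) * r (M (.inl i) (.inl j))) +
          ∑ i, ξ (.inr i) * r (M (.inr i) (.inl j)) := by
      funext j
      rw [grassCol, Fintype.sum_sum_type]
    rw [hc]
    have hinr : ∀ i, ξ (.inr i) * (List.ofFn fun j => ξ (.inr j)).prod = 0 := by
      intro i
      have h := prod_eq_zero_of_not_injective (fun i j => hξa (.inr i) (.inr j)) (l := n + 1)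
        (f := (Fin.cons i id : Fin (n + 1) → Fin n)) (fun h => by
          have := @h 0 i.succ (by simp)
          exact absurd this (Fin.succ_ne_zero i).symm)
      simpa [List.ofFn_succ] using h
    refine prod_absorb_left _ _ _ (fun g => ∃ Z : Fin n → GrassExt R (Fin m ⊕ Fin n),
      g = ∑ i, Z i * ξ (.inr i)) (fun j => ⟨fun i => r (M (.inr i) (.inl j)), ?_⟩) ?_ ?_
    · exact Finset.sum_congr rfl fun i _ => (grassCoeff_comm _ _).symm
    · rintro _ ⟨Z, rfl⟩
      rw [Finset.sum_mul]
      refine Finset.sum_eq_zero fun i _ => ?_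
      rw [mul_assoc, hinr, mul_zero]
    · rintro _ j ⟨Z, rfl⟩
      refine ⟨fun i => -(Z i * ∑ a, ξ (.inl a) * r (M (.inl a) (.inl j))), ?_⟩
      rw [Finset.sum_mul]
      refine Finset.sum_congr rfl fun i _ => ?_
      rw [mul_assoc, neg_mul, mul_assoc, ← mul_neg, Finset.mul_sum, Finset.sum_mul,
        ← Finset.sum_neg_distrib]
      congr 1
      refine Finset.sum_congr rfl fun a _ => ?_
      rw [← mul_assoc, hξa, neg_mul, mul_assoc, mul_assoc, grassCoeff_comm]
  have h5 := prod_columns r (x := fun i : Fin m => ξ (.inl i)) (fun i j => hξa _ _)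
    (fun i y => grassCoeff_comm _ _) (Matrix.of fun i j => M (.inl i) (.inl j))
  have hcomm : Commute (r (cdet (Matrix.of fun i j => M (.inl i) (.inl j))))
      (List.ofFn fun j => ξ (.inr j)).prod := by
    refine Commute.list_prod_right _ _ fun y hy => ?_
    obtain ⟨j, rfl⟩ := List.mem_ofFn.mp hy
    exact grassCoeff_comm _ _
  refine grassTop_mul_injective finSumFinEquiv.symm (h1.symm.trans ?_)
  rw [h2, h3, ← mul_assoc, h4]
  simp only [Matrix.of_apply] at h5
  rw [h5, mul_assoc _ (r _), hcomm.eq, hsplit (grassGen R), map_mul]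
  simp only [mul_assoc]
  rfl

end ColumnDeterminant

/-! ### Multilinear expansions, principal minors and derivations -/

section CdetExpansions

variable {R : Type*} [Ring R] {k : ℕ}

theorem derivation_list_prod {R : Type*} [Ring R] (δ : R →+ R)
    (hδ : ∀ x y, δ (x * y) = δ x * y + x * δ y)
    {k : ℕ} (v : Fin k → R) :
    δ (List.ofFn v).prod = ∑ t, (List.ofFn (Function.update v t (δ (v t)))).prod := by
  have h1 : δ 1 = 0 := by simpa using hδ 1 1
  induction k with
  | zero => simpa using h1
  | succ k ih =>
    rw [Fin.sum_univ_succ]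
    simp only [List.ofFn_succ, List.prod_cons, hδ, Function.update_self]
    congr 1
    rw [ih fun j => v j.succ, Finset.mul_sum]
    refine Finset.sum_congr rfl fun t _ => ?_
    rw [Function.update_of_ne (Fin.succ_ne_zero t).symm]
    congr 3
    funext j
    by_cases h : j = t
    · subst h; simp
    · rw [Function.update_of_ne h, Function.update_of_ne (fun hh => h (Fin.succ_injective _ hh))]

theorem derivation_cdet {R : Type*} [Ring R] (δ : R →+ R)
    (hδ : ∀ x y, δ (x * y) = δ x * y + x * δ y)
    (M : Matrix (Fin k) (Fin k) R) :
    δ (cdet M) = ∑ t, cdet (Matrix.of fun i j => if j = t then δ (M i j) else M i j) := by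
  simp only [cdet, map_sum, map_zsmul]
  rw [Finset.sum_comm]
  refine Finset.sum_congr rfl fun σ _ => ?_
  rw [derivation_list_prod δ hδ, Finset.smul_sum]
  refine Finset.sum_congr rfl fun t _ => ?_
  congr 3
  funext j
  by_cases h : j = t
  · subst h; simp
  · simp [h]

theorem list_prod_eq_zero_of_apply_eq_zero {R : Type*} [Ring R] {k : ℕ} {v : Fin k → R} (t : Fin k)
    (h : v t = 0) : (List.ofFn v).prod = 0 :=
  List.prod_eq_zero (List.mem_ofFn.mpr ⟨t, h⟩)

theorem cdet_add (A B : Matrix (Fin k) (Fin k) R) :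
    cdet (Matrix.of fun i j => A i j + B i j) =
      ∑ s : Finset (Fin k), cdet (Matrix.of fun i j => if j ∈ s then A i j else B i j) := by
  simp only [cdet]
  rw [Finset.sum_comm]
  refine Finset.sum_congr rfl fun σ _ => ?_
  rw [← Finset.smul_sum]
  congr 1
  have := MultilinearMap.map_add_univ (MultilinearMap.mkPiAlgebraFin ℤ k R)
    (fun j => A (σ j) j) (fun j => B (σ j) j)
  simp only [MultilinearMap.mkPiAlgebraFin_apply] at this
  exact this

theorem cdet_neg_columns (A B : Matrix (Fin k) (Fin k) R) (s : Finset (Fin k)) :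
    cdet (Matrix.of fun i j => if j ∈ s then -A i j else B i j) =
      (-1 : ℤ) ^ s.card • cdet (Matrix.of fun i j => if j ∈ s then A i j else B i j) := by
  simp only [cdet, Finset.smul_sum]
  refine Finset.sum_congr rfl fun σ _ => ?_
  rw [smul_comm]
  congr 1
  have := MultilinearMap.map_piecewise_smul (MultilinearMap.mkPiAlgebraFin ℤ k R) (fun _ => -1)
    (s.piecewise (fun j => A (σ j) j) (fun j => B (σ j) j)) s
  simp only [MultilinearMap.mkPiAlgebraFin_apply, Finset.prod_const] at this
  refine Eq.trans ?_ this
  congr 2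
  funext j
  by_cases h : j ∈ s <;> simp [h, Finset.piecewise]

theorem cdet_eq_zero_of_column (M : Matrix (Fin k) (Fin k) R) (t : Fin k) (h : ∀ i, M i t = 0) :
    cdet M = 0 := by
  refine Finset.sum_eq_zero fun σ _ => ?_
  rw [list_prod_eq_zero_of_apply_eq_zero (v := fun j => M (σ j) j) t (h _), smul_zero]

/-- The principal minor on the rows and columns in `K`, as the determinant of the matrix in which
all other columns are unit columns. -/
def minor (K : Finset (Fin k)) (M : Matrix (Fin k) (Fin k) R) : R :=
  cdet (Matrix.of fun i j => if j ∈ K then M i j else if i = j then 1 else 0)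

/-- Expand by columns, K being the set of columns taken from -M. A column outside both K and I is
zero, so only the K containing the complement of I survive. -/
theorem cdet_diagonal_sub (I : Finset (Fin k)) (M : Matrix (Fin k) (Fin k) R) :
    cdet (Matrix.of fun i j => (if i = j ∧ j ∈ I then 1 else 0) - M i j) =
      ∑ K : Finset (Fin k) with Iᶜ ⊆ K, (-1 : ℤ) ^ K.card • minor K M := by
  simp only [sub_eq_neg_add]
  refine (cdet_add (-M) (Matrix.of fun i j => if i = j ∧ j ∈ I then 1 else 0)).trans ?_
  rw [Finset.sum_filter]
  refine Finset.sum_congr rfl fun K _ => ?_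
  refine (cdet_neg_columns M (Matrix.of fun i j => if i = j ∧ j ∈ I then 1 else 0) K).trans ?_
  split_ifs with h
  · congr 2
    ext i j
    by_cases hj : j ∈ K
    · simp [hj]
    · have : j ∈ I := by
        by_contra hI
        exact hj (h (Finset.mem_compl.mpr hI))
      simp [hj, this]
  · obtain ⟨t, ht, htK⟩ := Finset.not_subset.mp h
    rw [cdet_eq_zero_of_column _ t, smul_zero]
    intro i
    simp [htK, Finset.mem_compl.mp ht]

theorem cdet_one_sub (M : Matrix (Fin k) (Fin k) R) :
    cdet (1 - M) = ∑ K : Finset (Fin k), (-1 : ℤ) ^ K.card • minor K M := by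
  have := cdet_diagonal_sub Finset.univ M
  simp only [Finset.mem_univ, and_true, Finset.compl_univ, Finset.empty_subset,
    Finset.filter_true] at this
  rw [← this]
  congr 1

/-- Composing σ with the transposition of the two rows leaves the factors and their column order
unchanged and flips the sign. Hence no commutation relation is needed, in contrast to the case of
equal columns. -/
theorem cdet_of_row_eq {R : Type*} [Ring R] (M : Matrix (Fin k) (Fin k) R) {a b : Fin k}
    (hab : a ≠ b) (h : ∀ j, M a j = M b j) : cdet M = 0 := by
  refine Finset.sum_involution (fun σ _ => Equiv.swap a b * σ) ?_ ?_ ?_ ?_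
  · intro σ _
    have hM : ∀ i j, M (Equiv.swap a b i) j = M i j := by
      intro i j
      rcases eq_or_ne i a with rfl | hia
      · rw [Equiv.swap_apply_left, h]
      · rcases eq_or_ne i b with rfl | hib
        · rw [Equiv.swap_apply_right, h]
        · rw [Equiv.swap_apply_of_ne_of_ne hia hib]
    simp [Equiv.Perm.sign_swap hab, hM]
  · intro σ _ _ hσ
    have := mul_eq_right.mp hσ
    exact hab (Equiv.swap_eq_one_iff.mp this)
  · simp
  · intro σ _
    rw [← mul_assoc, Equiv.swap_mul_self, one_mul]

/-- A derivation acting on the matrix like a matrix unit kills the column determinant. -/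
theorem IsManin.derivation_cdet_eq_zero [Algebra ℂ R] {M : Matrix (Fin k) (Fin k) R} (hM : IsManin M)
    (δ : R →+ R) (hδ : ∀ x y, δ (x * y) = δ x * y + x * δ y) (a b : Fin k)
    (h : ∀ i j, δ (M i j) = (if i = b then M a j else 0) - (if j = a then M i b else 0)) :
    δ (cdet M) = 0 := by
  have hsub : ∀ t, cdet (Matrix.of fun i j => if j = t then δ (M i j) else M i j) =
      cdet (Matrix.of fun i j => if j = t then (if i = b then M a j else 0) else M i j) -
      cdet (Matrix.of fun i j => if j = t then (if j = a then M i b else 0) else M i j) := by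
    intro t
    simp only [cdet]
    rw [← Finset.sum_sub_distrib]
    refine Finset.sum_congr rfl fun σ _ => ?_
    rw [← smul_sub]
    congr 1
    have := MultilinearMap.map_update_sub (MultilinearMap.mkPiAlgebraFin ℤ k R)
      (fun j => M (σ j) j) t (if σ t = b then M a t else 0) (if t = a then M (σ t) b else 0)
    simp only [MultilinearMap.mkPiAlgebraFin_apply] at this
    convert this using 3 <;>
    · congr 1
      funext j
      by_cases hj : j = t
      · subst hj; simp [h]
      · simp [hj]
  have hrow : ∑ t, cdet (Matrix.of fun i j =>
      if j = t then (if i = b then M a j else 0) else M i j) =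
      cdet (Matrix.of fun i j => if i = b then M a j else M i j) := by
    simp only [cdet]
    rw [Finset.sum_comm]
    refine Finset.sum_congr rfl fun σ _ => ?_
    rw [← Finset.smul_sum]
    congr 1
    rw [Finset.sum_eq_single (σ.symm b)]
    · congr 2
      funext j
      by_cases hj : j = σ.symm b
      · subst hj; simp
      · have : σ j ≠ b := fun hh => hj (by rw [← hh, Equiv.symm_apply_apply])
        simp [hj, this]
    · intro t _ ht
      refine list_prod_eq_zero_of_apply_eq_zero t ?_
      have : σ t ≠ b := fun hh => ht (by rw [← hh, Equiv.symm_apply_apply])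
      simp [this]
    · simp
  have hcol : ∑ t, cdet (Matrix.of fun i j =>
      if j = t then (if j = a then M i b else 0) else M i j) =
      cdet (Matrix.of fun i j => M i (Function.update id a b j)) := by
    rw [Finset.sum_eq_single a]
    · congr 1
      ext i j
      by_cases hj : j = a
      · subst hj; simp
      · simp [hj]
    · intro t _ ht
      refine cdet_eq_zero_of_column _ t fun i => ?_
      simp [ht]
    · simp
  rw [derivation_cdet δ hδ]
  simp only [hsub]
  rw [Finset.sum_sub_distrib, hrow, hcol]
  -- The first sum has put row a in place of row b, the second column b in place of column a. For a
  -- = b both are `cdet M`; otherwise the first has equal rows and the second equal columns, where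
  -- the Manin property enters.
  rcases eq_or_ne a b with rfl | hab
  · rw [sub_eq_zero]
    congr 1
    ext i j
    by_cases hi : i = a <;> by_cases hj : j = a <;> simp [hi, hj]
  · rw [hM.cdet_column_eq_zero, sub_zero]
    · refine cdet_of_row_eq _ hab fun j => ?_
      simp [hab]
    · intro hinj
      have := @hinj a b (by simp [hab.symm])
      exact hab this

/-- The action on minors of a derivation mapping the matrix to the identity matrix. -/
theorem derivation_minor (δ : R →+ R) (hδ : ∀ x y, δ (x * y) = δ x * y + x * δ y)
    {M : Matrix (Fin k) (Fin k) R} (h : ∀ i j, δ (M i j) = if i = j then 1 else 0)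
    (K : Finset (Fin k)) : δ (minor K M) = ∑ t ∈ K, minor (K.erase t) M := by
  have h1 : δ 1 = 0 := by simpa using hδ 1 1
  rw [minor, derivation_cdet δ hδ, ← Finset.sum_subset (Finset.subset_univ K)]
  · refine Finset.sum_congr rfl fun t ht => ?_
    rw [minor]
    congr 1
    ext i j
    by_cases hj : j = t
    · subst hj; simp [h, ht]
    · simp [hj]
  · intro t _ ht
    refine cdet_eq_zero_of_column _ t fun i => ?_
    simp only [Matrix.of_apply, if_true, ht, if_false]
    split_ifs <;> simp [h1]

end CdetExpansions

/-! ### The shift operators -/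

section Shift

set_option linter.unusedSectionVars false

variable {A : Type*} [Ring A] [Algebra ℂ A]

theorem coeff_shift (c : ℂ) (f : A⸨X⸩) (r : ℤ) : (shift c f).coeff r =
    ∑ᶠ p : ℕ, (((Ring.choose (-(r - (p : ℤ))) p : ℤ) : ℂ) * c ^ p) • f.coeff (r - (p : ℤ)) := rfl

/-- The condition that every coefficient of `F f` is determined by coefficients of bounded
degree of `f`. -/
def CoeffContinuous {B : Type*} [Ring B] (F : A⸨X⸩ → B⸨X⸩) : Prop :=
  ∀ r : ℤ, ∃ s : ℤ, ∀ f : A⸨X⸩, (∀ k ≤ s, f.coeff k = 0) → ∀ k ≤ r, (F f).coeff k = 0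

theorem coeffContinuous_shift (c : ℂ) : CoeffContinuous (shift (A := A) c) := by
  refine fun r => ⟨r, fun f hf k hk => ?_⟩
  rw [coeff_shift]
  refine finsum_eq_zero_of_forall_eq_zero fun p => ?_
  rw [hf _ (by omega), smul_zero]

theorem coeffContinuous_mul_right (g : A⸨X⸩) : CoeffContinuous (fun f : A⸨X⸩ => f * g) := by
  refine fun r => ⟨r - g.order, fun f hf k hk => ?_⟩
  rw [HahnSeries.coeff_mul]
  refine Finset.sum_eq_zero fun ij hij => ?_
  obtain ⟨_, h2, h3⟩ := Finset.mem_antidiagonal.mp hij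
  have := HahnSeries.order_le_of_coeff_ne_zero h2
  rw [hf _ (by omega), zero_mul]

theorem coeffContinuous_mul_left (g : A⸨X⸩) : CoeffContinuous (fun f : A⸨X⸩ => g * f) := by
  refine fun r => ⟨r - g.order, fun f hf k hk => ?_⟩
  rw [HahnSeries.coeff_mul]
  refine Finset.sum_eq_zero fun ij hij => ?_
  obtain ⟨h2, _, h3⟩ := Finset.mem_antidiagonal.mp hij
  have := HahnSeries.order_le_of_coeff_ne_zero h2
  rw [hf _ (by omega), mul_zero]

theorem CoeffContinuous.comp {B C : Type*} [Ring B] [Ring C] {F : B⸨X⸩ → C⸨X⸩} {G : A⸨X⸩ → B⸨X⸩}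
    (hF : CoeffContinuous F) (hG : CoeffContinuous G) : CoeffContinuous fun f => F (G f) := by
  intro r
  obtain ⟨s, hs⟩ := hF r
  obtain ⟨t, ht⟩ := hG s
  exact ⟨t, fun f hf => hs _ (ht f hf)⟩

/-- Continuous additive maps are determined by their values on monomials. -/
theorem CoeffContinuous.ext {B : Type*} [Ring B] {F G : A⸨X⸩ →+ B⸨X⸩}
    (hF : CoeffContinuous F) (hG : CoeffContinuous G)
    (h : ∀ k a, F (HahnSeries.single k a) = G (HahnSeries.single k a)) : F = G := by
  ext f r
  obtain ⟨s, hs⟩ := hF r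
  obtain ⟨t, ht⟩ := hG r
  -- A finite truncation of f, long enough that neither F nor G can detect f - g at the coefficient
  -- r.
  set g : A⸨X⸩ := ∑ k ∈ Finset.Icc f.order (max s t), HahnSeries.single k (f.coeff k) with hg
  have hcoeff : ∀ k ≤ max s t, (f - g).coeff k = 0 := by
    intro k hk
    rw [HahnSeries.coeff_sub, hg, HahnSeries.coeff_sum]
    by_cases hkf : k < f.order
    · rw [HahnSeries.coeff_eq_zero_of_lt_order hkf, zero_sub, neg_eq_zero]
      refine Finset.sum_eq_zero fun x hx => HahnSeries.coeff_single_of_ne ?_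
      have := (Finset.mem_Icc.mp hx).1
      omega
    · rw [Finset.sum_eq_single k, HahnSeries.coeff_single_same, sub_self]
      · exact fun x _ hx => HahnSeries.coeff_single_of_ne hx.symm
      · exact fun hx => absurd (Finset.mem_Icc.mpr ⟨not_lt.mp hkf, hk⟩) hx
  have hg2 : F g = G g := by
    rw [hg, map_sum, map_sum]
    exact Finset.sum_congr rfl fun k _ => h k _
  have h1 := hs (f - g) (fun k hk => hcoeff k (hk.trans (le_max_left _ _))) r le_rfl
  have h2 := ht (f - g) (fun k hk => hcoeff k (hk.trans (le_max_right _ _))) r le_rfl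
  rw [map_sub, HahnSeries.coeff_sub, sub_eq_zero] at h1 h2
  rw [h1, h2, hg2]

/-- The expansion of `(1 + c u⁻¹)^{-k}`. -/
def shiftFactor (A : Type*) [Ring A] [Algebra ℂ A] (c : ℂ) (k : ℤ) : A⸨X⸩ :=
  HahnSeries.ofPowerSeries ℤ A (PowerSeries.map (algebraMap ℂ A)
    (PowerSeries.rescale c (PowerSeries.binomialSeries ℂ (-k))))

theorem shiftFactor_add (c : ℂ) (k l : ℤ) :
    shiftFactor A c (k + l) = shiftFactor A c k * shiftFactor A c l := by
  rw [shiftFactor, neg_add, PowerSeries.binomialSeries_add, map_mul, map_mul, map_mul]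
  rfl

theorem shiftFactor_commute_single (c : ℂ) (k l : ℤ) (a : A) :
    shiftFactor A c k * HahnSeries.single l a = HahnSeries.single l a * shiftFactor A c k := by
  ext r
  rw [HahnSeries.coeff_single_mul, HahnSeries.coeff_mul_single, shiftFactor,
    PowerSeries.coeff_coe]
  split_ifs
  · simp
  · rw [PowerSeries.coeff_map]
    exact Algebra.commutes _ _

theorem shift_single (c : ℂ) (k : ℤ) (a : A) :
    shift c (HahnSeries.single k a) = HahnSeries.single k a * shiftFactor A c k := by
  ext r
  rw [coeff_shift, HahnSeries.coeff_single_mul, shiftFactor, PowerSeries.coeff_coe]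
  split_ifs with h
  · rw [mul_zero]
    refine finsum_eq_zero_of_forall_eq_zero fun p => ?_
    rw [HahnSeries.coeff_single_of_ne (by omega), smul_zero]
  · rw [finsum_eq_single _ (r - k).natAbs]
    · have : r - ((r - k).natAbs : ℤ) = k := by omega
      rw [this, HahnSeries.coeff_single_same, PowerSeries.coeff_map, PowerSeries.coeff_rescale,
        PowerSeries.binomialSeries_coeff, ← Algebra.commutes, ← Algebra.smul_def]
      congr 1
      rw [mul_comm, zsmul_eq_mul, mul_one]
    · intro p hp
      rw [HahnSeries.coeff_single_of_ne (by omega), smul_zero]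

/-- By continuity in each argument it suffices to treat monomials, where the claim is the exponent
law for (1 + c u⁻¹)^{-k}; this series commutes with all monomials because its coefficients are
scalars. -/
theorem shift_mul (c : ℂ) (f g : A⸨X⸩) : shift c (f * g) = shift c f * shift c g := by
  have h1 : ∀ (k : ℤ) (a : A) (g : A⸨X⸩),
      shift c (HahnSeries.single k a * g) = shift c (HahnSeries.single k a) * shift c g := by
    intro k a g
    have := CoeffContinuous.ext (A := A) (B := A)
      (F := (shift c).toAddMonoidHom.comp (AddMonoidHom.mulLeft (HahnSeries.single k a)))
      (G := (AddMonoidHom.mulLeft (shift c (HahnSeries.single k a))).comp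
        (shift c).toAddMonoidHom)
      ((coeffContinuous_shift c).comp (coeffContinuous_mul_left _))
      ((coeffContinuous_mul_left _).comp (coeffContinuous_shift c)) (fun l b => by
        change shift c (HahnSeries.single k a * HahnSeries.single l b) =
          shift c (HahnSeries.single k a) * shift c (HahnSeries.single l b)
        rw [HahnSeries.single_mul_single, shift_single, shift_single, shift_single,
          shiftFactor_add, ← HahnSeries.single_mul_single]
        simp only [mul_assoc]
        rw [← mul_assoc (shiftFactor A c k), shiftFactor_commute_single, mul_assoc])
    exact DFunLike.congr_fun this g
  have := CoeffContinuous.ext (A := A) (B := A)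
    (F := (shift c).toAddMonoidHom.comp (AddMonoidHom.mulRight g))
    (G := (AddMonoidHom.mulRight (shift c g)).comp (shift c).toAddMonoidHom)
    ((coeffContinuous_shift c).comp (coeffContinuous_mul_right _))
    ((coeffContinuous_mul_right _).comp (coeffContinuous_shift c)) (fun l b => h1 l b g)
  exact DFunLike.congr_fun this f

theorem shiftFactor_zero_right (c : ℂ) : shiftFactor A c 0 = 1 := by
  rw [shiftFactor, neg_zero, PowerSeries.binomialSeries_zero, map_one, map_one, map_one]

theorem shiftFactor_zero_left (k : ℤ) : shiftFactor A 0 k = 1 := by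
  rw [shiftFactor, PowerSeries.rescale_zero]
  simp

theorem shift_C (c : ℂ) (a : A) : shift c (HahnSeries.C a) = HahnSeries.C a := by
  rw [HahnSeries.C_apply, shift_single, shiftFactor_zero_right, mul_one]

theorem shift_one_apply (c : ℂ) : shift c (1 : A⸨X⸩) = 1 := by
  rw [← HahnSeries.C_one, shift_C]

theorem shift_zero : shift (A := A) 0 = 1 := by
  ext1 f
  have := CoeffContinuous.ext (A := A) (B := A)
    (F := (shift 0).toAddMonoidHom) (G := AddMonoidHom.id _)
    (coeffContinuous_shift 0) (fun r => ⟨r, fun f hf => hf⟩) (fun l b => by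
      change shift 0 (HahnSeries.single l b) = HahnSeries.single l b
      rw [shift_single, shiftFactor_zero_left, mul_one])
  exact DFunLike.congr_fun this f

/-- The variable `u`. -/
def seriesU (A : Type*) [Ring A] : A⸨X⸩ := HahnSeries.single (-1) 1

/-- The series `u⁻¹`. -/
def seriesW (A : Type*) [Ring A] : A⸨X⸩ := HahnSeries.single 1 1

theorem seriesU_mul_seriesW : seriesU A * seriesW A = 1 := by
  rw [seriesU, seriesW, HahnSeries.single_mul_single]
  simp

theorem seriesW_mul_seriesU : seriesW A * seriesU A = 1 := by
  rw [seriesU, seriesW, HahnSeries.single_mul_single]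
  simp

theorem seriesU_comm (f : A⸨X⸩) : seriesU A * f = f * seriesU A := by
  ext r
  rw [seriesU, HahnSeries.coeff_single_mul, HahnSeries.coeff_mul_single, one_mul, mul_one]

theorem seriesW_comm (f : A⸨X⸩) : seriesW A * f = f * seriesW A := by
  ext r
  rw [seriesW, HahnSeries.coeff_single_mul, HahnSeries.coeff_mul_single, one_mul, mul_one]

theorem shift_seriesU (c : ℂ) : shift c (seriesU A) = seriesU A + algebraMap ℂ A⸨X⸩ c := by
  have h : shiftFactor A c (-1) = 1 + algebraMap ℂ A⸨X⸩ c * seriesW A := by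
    rw [shiftFactor, neg_neg]
    have := PowerSeries.binomialSeries_nat (R := ℤ) (A := ℂ) 1
    rw [Nat.cast_one, pow_one] at this
    rw [this, map_add, map_one, map_add, map_one, map_add, map_one, PowerSeries.rescale_X,
      map_mul, map_mul, PowerSeries.map_X, PowerSeries.map_C, HahnSeries.ofPowerSeries_C,
      HahnSeries.ofPowerSeries_X]
    rfl
  rw [seriesU, shift_single, ← seriesU, h, mul_add, mul_one, ← mul_assoc, seriesU_comm,
    mul_assoc, seriesU_mul_seriesW, mul_one]

/-- Both sides are multiplicative and agree on u, hence on its powers, hence on the powers of u⁻¹ by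
uniqueness of inverses. Continuity then extends the equality from monomials to all series. -/
theorem shift_shift (c d : ℂ) (f : A⸨X⸩) : shift c (shift d f) = shift (c + d) f := by
  have hU : shift c (shift d (seriesU A)) = shift (c + d) (seriesU A) := by
    rw [shift_seriesU, map_add, shift_seriesU, shift_seriesU, map_add, ← add_assoc]
    congr 1
    exact shift_C _ _
  have hUpow : ∀ n : ℕ, shift c (shift d (seriesU A ^ n)) = shift (c + d) (seriesU A ^ n) := by
    intro n
    induction n with
    | zero => simp only [pow_zero, shift_one_apply]
    | succ n ih => rw [pow_succ, shift_mul, shift_mul, shift_mul, ih, hU]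
  have hinv : ∀ (e : ℂ) (n : ℕ), shift e (seriesU A ^ n) * shift e (seriesW A ^ n) = 1 := by
    intro e n
    rw [← shift_mul, ← (Commute.mul_pow (seriesU_comm (seriesW A)) n), seriesU_mul_seriesW,
      one_pow, shift_one_apply]
  have hinv' : ∀ (e : ℂ) (n : ℕ), shift e (seriesW A ^ n) * shift e (seriesU A ^ n) = 1 := by
    intro e n
    rw [← shift_mul, ← (Commute.mul_pow (seriesW_comm (seriesU A)) n), seriesW_mul_seriesU,
      one_pow, shift_one_apply]
  have hWpow : ∀ n : ℕ, shift c (shift d (seriesW A ^ n)) = shift (c + d) (seriesW A ^ n) := by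
    intro n
    refine left_inv_eq_right_inv (a := shift (c + d) (seriesU A ^ n)) ?_ (hinv _ n)
    rw [← hUpow, ← shift_mul, hinv', shift_one_apply]
  have := CoeffContinuous.ext (A := A) (B := A)
    (F := (shift c).toAddMonoidHom.comp (shift d).toAddMonoidHom)
    (G := (shift (c + d)).toAddMonoidHom)
    ((coeffContinuous_shift c).comp (coeffContinuous_shift d)) (coeffContinuous_shift _)
    (fun k a => by
      change shift c (shift d (HahnSeries.single k a)) = shift (c + d) (HahnSeries.single k a)
      have hk : HahnSeries.single k a =
          HahnSeries.C a * HahnSeries.single k 1 := by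
        rw [HahnSeries.C_apply, HahnSeries.single_mul_single, zero_add, mul_one]
      have hs : ∃ n : ℕ, HahnSeries.single k (1 : A) = seriesU A ^ n ∨
          HahnSeries.single k (1 : A) = seriesW A ^ n := by
        refine ⟨k.natAbs, ?_⟩
        rw [seriesU, seriesW, HahnSeries.single_pow, HahnSeries.single_pow, one_pow]
        rcases le_total 0 k with h | h
        · right; congr 1; simp [abs_of_nonneg h]
        · left; congr 1; simp [abs_of_nonpos h]
      obtain ⟨n, hn | hn⟩ := hs
      · rw [hk, hn, shift_mul, shift_mul, shift_mul, hUpow, shift_C, shift_C, shift_C]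
      · rw [hk, hn, shift_mul, shift_mul, shift_mul, hWpow, shift_C, shift_C, shift_C])
  exact DFunLike.congr_fun this f

theorem shift_mul_shift (c d : ℂ) : shift (A := A) c * shift d = shift (c + d) :=
  LinearMap.ext (shift_shift c d)

theorem shift_map {B : Type*} [Ring B] [Algebra ℂ B] (h : A →ₐ[ℂ] B) (c : ℂ) (f : A⸨X⸩) :
    shift c (f.map h) = (shift c f).map h := by
  ext r
  rw [coeff_shift, HahnSeries.map_coeff, coeff_shift]
  have := AddMonoidHom.map_finsum (h : A →+ B) (shiftCoeff_finite c f r)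
  refine Eq.trans ?_ this.symm
  refine finsum_congr fun p => ?_
  simp

theorem coeff_shift_mem {S : Subalgebra ℂ A} (c : ℂ) {f : A⸨X⸩} (hf : ∀ r, f.coeff r ∈ S) (r : ℤ) :
    (shift c f).coeff r ∈ S := by
  rw [coeff_shift]
  exact finsum_induction (· ∈ S) S.zero_mem (fun _ _ => S.add_mem)
    fun p => S.smul_mem (hf _) _

theorem shift_ofPowerSeries (c : ℂ) (g : A⟦X⟧) :
    ∃ g' : A⟦X⟧, shift c (HahnSeries.ofPowerSeries ℤ A g) = HahnSeries.ofPowerSeries ℤ A g' ∧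
      PowerSeries.constantCoeff g' = PowerSeries.constantCoeff g := by
  refine ⟨PowerSeries.mk fun n => (shift c (HahnSeries.ofPowerSeries ℤ A g)).coeff n, ?_, ?_⟩
  · ext r
    rw [PowerSeries.coeff_coe]
    split_ifs with h
    · rw [coeff_shift]
      refine finsum_eq_zero_of_forall_eq_zero fun p => ?_
      rw [PowerSeries.coeff_coe, if_pos (by omega), smul_zero]
    · rw [PowerSeries.coeff_mk]
      congr 1
      omega
  · rw [← PowerSeries.coeff_zero_eq_constantCoeff_apply, PowerSeries.coeff_mk, coeff_shift,
      finsum_eq_single _ 0]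
    · simp [PowerSeries.coeff_coe]
    · intro p hp
      rw [PowerSeries.coeff_coe, if_pos (by omega), smul_zero]

end Shift

/-! ### Homogeneous difference operators -/

section Operators

set_option linter.unusedSectionVars false

variable {A : Type*} [Ring A] [Algebra ℂ A]

theorem mulOp_apply (f g : A⸨X⸩) : mulOp f g = f * g := rfl

theorem mulOp_mul_mulOp (f g : A⸨X⸩) : mulOp f * mulOp g = mulOp (f * g) :=
  LinearMap.ext fun x => (mul_assoc f g x).symm

theorem mulOp_one : mulOp (1 : A⸨X⸩) = 1 := LinearMap.ext fun x => one_mul x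

theorem mulOp_add (f g : A⸨X⸩) : mulOp (f + g) = mulOp f + mulOp g :=
  LinearMap.ext fun x => add_mul f g x

theorem mulOp_zero : mulOp (0 : A⸨X⸩) = 0 := LinearMap.ext fun x => zero_mul x

theorem mulOp_neg (f : A⸨X⸩) : mulOp (-f) = -mulOp f := LinearMap.ext fun x => neg_mul f x

theorem mulOp_sum {ι : Type*} (s : Finset ι) (f : ι → A⸨X⸩) :
    mulOp (∑ i ∈ s, f i) = ∑ i ∈ s, mulOp (f i) :=
  map_sum (AddMonoidHom.mk' (mulOp (A := A)) mulOp_add) f s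

theorem shift_mul_mulOp (c : ℂ) (f : A⸨X⸩) :
    shift c * mulOp f = mulOp (shift c f) * shift c :=
  LinearMap.ext fun x => shift_mul c f x

theorem tau_pow (k : ℕ) : (tau : Module.End ℂ A⸨X⸩) ^ k = shift (k : ℂ) := by
  induction k with
  | zero => rw [pow_zero, Nat.cast_zero, shift_zero]
  | succ k ih => rw [pow_succ, ih, tau, shift_mul_shift, Nat.cast_succ]

/-- Shifts fix the series 1, so evaluation at 1 reads off the coefficient series of a homogeneous
operator. This is used throughout to pass from operators back to series. -/
theorem mulOp_shift_apply_one (f : A⸨X⸩) (c : ℂ) : (mulOp f * shift c : Module.End ℂ A⸨X⸩) 1 = f := by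
  rw [Module.End.mul_apply, shift_one_apply, mulOp_apply, mul_one]

/-- The operators `f(u) τ^c` with coefficients of `f` in `S`. -/
def IsHomog (S : Subalgebra ℂ A) (c : ℂ) (x : Module.End ℂ A⸨X⸩) : Prop :=
  ∃ f : A⸨X⸩, (∀ r, f.coeff r ∈ S) ∧ x = mulOp f * shift c

theorem coeff_mul_mem {S : Subalgebra ℂ A} {f g : A⸨X⸩} (hf : ∀ r, f.coeff r ∈ S)
    (hg : ∀ r, g.coeff r ∈ S) (r : ℤ) : (f * g).coeff r ∈ S := by
  rw [HahnSeries.coeff_mul]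
  exact S.sum_mem fun _ _ => S.mul_mem (hf _) (hg _)

theorem coeff_single_one_mem (S : Subalgebra ℂ A) (k r : ℤ) :
    (HahnSeries.single k (1 : A)).coeff r ∈ S := by
  rw [HahnSeries.coeff_single]
  split_ifs
  exacts [S.one_mem, S.zero_mem]

namespace IsHomog

variable {S T : Subalgebra ℂ A} {c d : ℂ} {x y : Module.End ℂ A⸨X⸩}

theorem mono (hx : IsHomog S c x) (h : S ≤ T) : IsHomog T c x :=
  let ⟨f, hf, hx⟩ := hx
  ⟨f, fun r => h (hf r), hx⟩

theorem congr (hx : IsHomog S c x) (h : c = d) : IsHomog S d x := h ▸ hx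

theorem mul (hx : IsHomog S c x) (hy : IsHomog S d y) : IsHomog S (c + d) (x * y) := by
  obtain ⟨f, hf, rfl⟩ := hx
  obtain ⟨g, hg, rfl⟩ := hy
  refine ⟨f * shift c g, coeff_mul_mem hf (coeff_shift_mem c hg), ?_⟩
  rw [mul_assoc, ← mul_assoc (shift c), shift_mul_mulOp, mul_assoc, shift_mul_shift, ← mul_assoc,
    mulOp_mul_mulOp]

theorem add (hx : IsHomog S c x) (hy : IsHomog S c y) : IsHomog S c (x + y) := by
  obtain ⟨f, hf, rfl⟩ := hx
  obtain ⟨g, hg, rfl⟩ := hy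
  refine ⟨f + g, fun r => S.add_mem (hf r) (hg r), ?_⟩
  rw [mulOp_add, add_mul]

theorem zero : IsHomog S c (0 : Module.End ℂ A⸨X⸩) :=
  ⟨0, fun _ => S.zero_mem, by rw [mulOp_zero, zero_mul]⟩

theorem smul (a : ℂ) (hx : IsHomog S c x) : IsHomog S c (a • x) := by
  obtain ⟨f, hf, rfl⟩ := hx
  refine ⟨a • f, fun r => S.smul_mem (hf r) a, ?_⟩
  rw [← smul_mul_assoc]
  congr 1
  exact LinearMap.ext fun x => (smul_mul_assoc a f x).symm

theorem neg (hx : IsHomog S c x) : IsHomog S c (-x) := by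
  have h : -x = (-1 : ℂ) • x := (neg_one_smul ℂ x).symm
  exact h ▸ hx.smul (-1)

theorem sub (hx : IsHomog S c x) (hy : IsHomog S c y) : IsHomog S c (x - y) := by
  rw [sub_eq_add_neg]
  exact hx.add hy.neg

theorem eq_mulOp (hx : IsHomog S c x) : x = mulOp (x 1) * shift c := by
  obtain ⟨f, -, rfl⟩ := hx
  rw [mulOp_shift_apply_one]

theorem coeff_mem (hx : IsHomog S c x) (r : ℤ) : (x 1).coeff r ∈ S := by
  obtain ⟨f, hf, rfl⟩ := hx
  rw [mulOp_shift_apply_one]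
  exact hf r

theorem of_shift (S : Subalgebra ℂ A) (c : ℂ) : IsHomog S c (shift c) :=
  ⟨1, fun r => coeff_single_one_mem S 0 r, by rw [mulOp_one, one_mul]⟩

theorem of_mulOp {f : A⸨X⸩} (hf : ∀ r, f.coeff r ∈ S) : IsHomog S 0 (mulOp f) :=
  ⟨f, hf, by rw [shift_zero, mul_one]⟩

end IsHomog

/-- Homogeneous operators of distinct degrees are linearly independent. -/
theorem homog_eq_zero_of_sum_eq_zero {ι : Type*} (s : Finset ι) {c : ι → ℂ}
    (hc : Function.Injective c) {x : ι → Module.End ℂ A⸨X⸩}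
    (hx : ∀ i ∈ s, IsHomog ⊤ (c i) (x i)) (h : ∑ i ∈ s, x i = 0) : ∀ i ∈ s, x i = 0 := by
  -- Since τ^c u = (u + c) τ^c, the operator f(u) τ^c is an eigenvector of x ↦ [x, u] with
  -- eigenvalue c, and eigenspaces for distinct eigenvalues are independent.
  let L : Module.End ℂ (Module.End ℂ A⸨X⸩) :=
    LinearMap.mulRight ℂ (mulOp (seriesU A)) - LinearMap.mulLeft ℂ (mulOp (seriesU A))
  have hL : ∀ i ∈ s, x i ∈ L.eigenspace (c i) := by
    intro i hi
    obtain ⟨f, -, hf⟩ := hx i hi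
    rw [Module.End.mem_eigenspace_iff]
    change x i * mulOp (seriesU A) - mulOp (seriesU A) * x i = c i • x i
    have h1 : mulOp (algebraMap ℂ A⸨X⸩ (c i)) = algebraMap ℂ (Module.End ℂ A⸨X⸩) (c i) :=
      LinearMap.ext fun v => (Algebra.smul_def _ _).symm
    have h2 : x i * mulOp (seriesU A) = mulOp (seriesU A) * x i +
        algebraMap ℂ (Module.End ℂ A⸨X⸩) (c i) * x i := by
      rw [hf, mul_assoc, shift_mul_mulOp, shift_seriesU, ← mul_assoc, mulOp_mul_mulOp, mul_add,
        mulOp_add, add_mul, ← seriesU_comm, ← mulOp_mul_mulOp, ← mulOp_mul_mulOp, h1,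
        ← Algebra.commutes, mul_assoc, mul_assoc]
    rw [h2, add_sub_cancel_left, Algebra.smul_def]
  have := (iSupIndep_iff_finsetSum_eq_zero_imp_eq_zero _).mp
    (L.eigenspaces_iSupIndep.comp hc)
  exact this s x hL h

/-- The operators `f(u) τ^c` where `f` is a power series in `u⁻¹` with constant term `a`. -/
def IsHomogPS (c : ℂ) (a : A) (x : Module.End ℂ A⸨X⸩) : Prop :=
  ∃ g : A⟦X⟧, x = mulOp (HahnSeries.ofPowerSeries ℤ A g) * shift c ∧
    PowerSeries.constantCoeff g = a

namespace IsHomogPS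

variable {c d : ℂ} {a b : A} {x y : Module.End ℂ A⸨X⸩}

theorem isHomog (hx : IsHomogPS c a x) : IsHomog ⊤ c x :=
  let ⟨_, hx, _⟩ := hx
  ⟨_, fun _ => trivial, hx⟩

theorem mul (hx : IsHomogPS c a x) (hy : IsHomogPS d b y) : IsHomogPS (c + d) (a * b) (x * y) := by
  obtain ⟨f, rfl, rfl⟩ := hx
  obtain ⟨g, rfl, rfl⟩ := hy
  obtain ⟨g', hg', hc⟩ := shift_ofPowerSeries c g
  refine ⟨f * g', ?_, by rw [map_mul, hc]⟩
  rw [mul_assoc, ← mul_assoc (shift c), shift_mul_mulOp, mul_assoc, shift_mul_shift, ← mul_assoc,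
    mulOp_mul_mulOp, hg', map_mul]

theorem add (hx : IsHomogPS c a x) (hy : IsHomogPS c b y) : IsHomogPS c (a + b) (x + y) := by
  obtain ⟨f, rfl, rfl⟩ := hx
  obtain ⟨g, rfl, rfl⟩ := hy
  exact ⟨f + g, by rw [map_add, mulOp_add, add_mul], by rw [map_add]⟩

theorem zero : IsHomogPS c (0 : A) 0 :=
  ⟨0, by rw [map_zero, mulOp_zero, zero_mul], by rw [map_zero]⟩

theorem neg (hx : IsHomogPS c a x) : IsHomogPS c (-a) (-x) := by
  obtain ⟨f, rfl, rfl⟩ := hx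
  refine ⟨-f, ?_, by rw [map_neg]⟩
  rw [map_neg, mulOp_neg]
  exact LinearMap.ext fun _ => rfl

theorem one : IsHomogPS 0 (1 : A) (1 : Module.End ℂ A⸨X⸩) :=
  ⟨1, by rw [map_one, mulOp_one, shift_zero, mul_one], by rw [map_one]⟩

theorem congr (hx : IsHomogPS c a x) (h : c = d) : IsHomogPS d a x := h ▸ hx

theorem list_prod {k : ℕ} {d : Fin k → ℂ} {a : Fin k → A} {x : Fin k → Module.End ℂ A⸨X⸩}
    (h : ∀ j, IsHomogPS (d j) (a j) (x j)) :
    IsHomogPS (∑ j, d j) (List.ofFn a).prod (List.ofFn x).prod := by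
  induction k with
  | zero => simpa using one
  | succ k ih =>
    rw [Fin.sum_univ_succ, List.ofFn_succ, List.ofFn_succ, List.prod_cons, List.prod_cons]
    exact (h 0).mul (ih fun j => h j.succ)

theorem cdet {k : ℕ} {d : Fin k → ℂ} {m : Matrix (Fin k) (Fin k) A}
    {M : Matrix (Fin k) (Fin k) (Module.End ℂ A⸨X⸩)}
    (h : ∀ i j, IsHomogPS (d j) (m i j) (M i j)) :
    IsHomogPS (∑ j, d j) (BetheDuality.cdet m) (BetheDuality.cdet M) := by
  have hsum : ∀ s : Finset (Equiv.Perm (Fin k)), IsHomogPS (∑ j, d j)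
      (∑ σ ∈ s, (Equiv.Perm.sign σ : ℤ) • (List.ofFn fun j => m (σ j) j).prod)
      (∑ σ ∈ s, (Equiv.Perm.sign σ : ℤ) • (List.ofFn fun j => M (σ j) j).prod) := by
    intro s
    induction s using Finset.induction_on with
    | empty => simpa using zero
    | insert σ s hσ ih =>
      rw [Finset.sum_insert hσ, Finset.sum_insert hσ]
      refine add ?_ ih
      have := list_prod fun j => h (σ j) j
      rcases Int.units_eq_one_or (Equiv.Perm.sign σ) with hs | hs
      · simpa [hs] using this
      · simpa [hs] using this.neg
  exact hsum Finset.univ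

/-- A homogeneous operator with constant term `1` is invertible over its ring of coefficients. -/
theorem exists_inv {S : Subalgebra ℂ A} (hx : IsHomogPS c (1 : A) x) (hS : IsHomog S c x) :
    ∃ y, IsHomog S (-c) y ∧ y * x = 1 ∧ x * y = 1 := by
  obtain ⟨g, rfl, hg⟩ := hx
  have hgS : ∀ n, PowerSeries.coeff n g ∈ S := by
    intro n
    have := hS.coeff_mem n
    rw [mulOp_shift_apply_one] at this
    simpa using this
  -- Inverting over `S` instead of over `A` keeps the coefficients of the inverse in `S`.
  let g' : S⟦X⟧ := PowerSeries.mk fun n => ⟨PowerSeries.coeff n g, hgS n⟩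
  have hg' : PowerSeries.map (S.val : S →+* A) g' = g := by
    ext n
    simp [g']
  have hc : PowerSeries.constantCoeff g' = ((1 : Sˣ) : S) := by
    rw [← PowerSeries.coeff_zero_eq_constantCoeff_apply, PowerSeries.coeff_mk]
    ext
    simpa using hg
  let k : A⟦X⟧ := PowerSeries.map (S.val : S →+* A) (PowerSeries.invOfUnit g' 1)
  have h1 : g * k = 1 := by
    rw [← hg', ← map_mul, PowerSeries.mul_invOfUnit _ _ hc, map_one]
  have h2 : k * g = 1 := by
    rw [← hg', ← map_mul, PowerSeries.invOfUnit_mul _ _ hc, map_one]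
  refine ⟨shift (-c) * mulOp (HahnSeries.ofPowerSeries ℤ A k), ?_, ?_, ?_⟩
  · have := (IsHomog.of_shift S (-c)).mul (IsHomog.of_mulOp (S := S)
      (f := HahnSeries.ofPowerSeries ℤ A k) fun r => ?_)
    · rwa [add_zero] at this
    · rw [PowerSeries.coeff_coe]
      split_ifs
      · exact S.zero_mem
      · rw [PowerSeries.coeff_map]
        exact Subtype.prop _
  · rw [mul_assoc, ← mul_assoc (mulOp _), mulOp_mul_mulOp, ← map_mul, h2, map_one, mulOp_one,
      one_mul, shift_mul_shift, neg_add_cancel, shift_zero]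
  · rw [mul_assoc, ← mul_assoc (shift c), shift_mul_shift, add_neg_cancel, shift_zero, one_mul,
      mulOp_mul_mulOp, ← map_mul, h1, map_one, mulOp_one]

end IsHomogPS

/-! ### Intertwining of operators by coefficient maps -/

variable {B : Type*} [Ring B] [Algebra ℂ B]

/-- The pairs of operators intertwined by the coefficientwise application of `h`. -/
def intertwined (h : A →ₐ[ℂ] B) : Subring (Module.End ℂ A⸨X⸩ × Module.End ℂ B⸨X⸩) where
  carrier := {p | ∀ v, p.2 (v.map h) = (p.1 v).map h}
  mul_mem' {p q} hp hq v := by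
    change p.2 (q.2 _) = (p.1 (q.1 v)).map h
    rw [hq, hp]
  one_mem' v := rfl
  add_mem' {p q} hp hq v := by
    change p.2 _ + q.2 _ = (p.1 v + q.1 v).map h
    rw [hp, hq]
    ext r
    simp
  zero_mem' v := by
    ext r
    simp
  neg_mem' {p} hp v := by
    change -p.2 _ = (-p.1 v).map h
    rw [hp]
    ext r
    simp

theorem shift_intertwined (h : A →ₐ[ℂ] B) (c : ℂ) : (shift c, shift c) ∈ intertwined h :=
  fun v => shift_map h c v

theorem mulOp_intertwined (h : A →ₐ[ℂ] B) (f : A⸨X⸩) :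
    (mulOp f, mulOp (f.map h)) ∈ intertwined h := by
  intro v
  exact (HahnSeries.map_mul (h : A →ₙ+* B)).symm

theorem map_cdet {R R' : Type*} [Ring R] [Ring R'] (φ : R →+* R') {k : ℕ}
    (M : Matrix (Fin k) (Fin k) R) : φ (cdet M) = cdet (M.map φ) := by
  simp only [cdet, map_sum, map_zsmul, map_list_prod, List.map_ofFn]
  rfl

theorem cdet_mem {R : Type*} [Ring R] (S : Subring R) {k : ℕ}
    {M : Matrix (Fin k) (Fin k) R} (h : ∀ i j, M i j ∈ S) : cdet M ∈ S := by
  refine S.sum_mem fun σ _ => S.zsmul_mem (S.list_prod_mem fun y hy => ?_) _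
  obtain ⟨j, rfl⟩ := List.mem_ofFn.mp hy
  exact h _ _

theorem cdet_intertwined (h : A →ₐ[ℂ] B) {k : ℕ}
    {M : Matrix (Fin k) (Fin k) (Module.End ℂ A⸨X⸩)}
    {M' : Matrix (Fin k) (Fin k) (Module.End ℂ B⸨X⸩)}
    (hM : ∀ i j, (M i j, M' i j) ∈ intertwined h) : (cdet M, cdet M') ∈ intertwined h := by
  let X : Matrix (Fin k) (Fin k) (Module.End ℂ A⸨X⸩ × Module.End ℂ B⸨X⸩) :=
    Matrix.of fun i j => (M i j, M' i j)
  have h1 : (cdet X).1 = cdet M :=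
    map_cdet (RingHom.fst (Module.End ℂ A⸨X⸩) (Module.End ℂ B⸨X⸩)) X
  have h2 : (cdet X).2 = cdet M' :=
    map_cdet (RingHom.snd (Module.End ℂ A⸨X⸩) (Module.End ℂ B⸨X⸩)) X
  have h3 : cdet X ∈ intertwined h := cdet_mem (intertwined h) hM
  rw [← h1, ← h2]
  exact h3

end Operators

/-! ### The coefficients of the Bethe operator -/

theorem cdet_one {k : ℕ} {R : Type*} [Ring R] : cdet (1 : Matrix (Fin k) (Fin k) R) = 1 := by
  rw [cdet, Finset.sum_eq_single 1]
  · have h : ∀ j : Fin k, (1 : Matrix (Fin k) (Fin k) R) ((1 : Equiv.Perm (Fin k)) j) j = 1 :=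
      fun j => Matrix.one_apply_eq j
    simp only [h, Equiv.Perm.sign_one, Units.val_one, one_smul, List.ofFn_const,
      List.prod_replicate, one_pow]
  · intro σ _ hσ
    obtain ⟨j, hj⟩ : ∃ j, σ j ≠ j := by
      by_contra! h
      exact hσ (Equiv.ext h)
    rw [list_prod_eq_zero_of_apply_eq_zero j, smul_zero]
    exact Matrix.one_apply_ne hj
  · simp

/-- The sum of the principal minors of size `k`. -/
def minorSum {n : ℕ} {R : Type*} [Ring R] (k : ℕ) (M : Matrix (Fin n) (Fin n) R) : R :=
  ∑ K : Finset (Fin n) with K.card = k, minor K M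

theorem cdet_one_sub_eq_minorSum {n : ℕ} {R : Type*} [Ring R] (M : Matrix (Fin n) (Fin n) R) :
    cdet (1 - M) = ∑ k : Fin (n + 1), (-1 : ℤ) ^ (k : ℕ) • minorSum k M := by
  rw [cdet_one_sub, Fin.sum_univ_eq_sum_range (fun k => (-1 : ℤ) ^ k • minorSum k M) (n + 1),
    ← Finset.sum_fiberwise_of_maps_to (g := Finset.card) (t := Finset.range (n + 1))]
  · refine Finset.sum_congr rfl fun k _ => ?_
    rw [minorSum, Finset.smul_sum]
    refine Finset.sum_congr rfl fun K hK => ?_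
    rw [(Finset.mem_filter.mp hK).2]
  · intro K _
    have := Finset.card_le_univ K
    rw [Fintype.card_fin] at this
    exact Finset.mem_range.mpr (by omega)

section Bethe

variable {A : Type*} [Ring A] [Algebra ℂ A] {n : ℕ}

theorem homog_eq_of_alternating_sum_eq {ι : Type*} (s : Finset ι) {c : ι → ℂ} (e : ι → ℕ)
    (hc : Function.Injective c) {x y : ι → Module.End ℂ A⸨X⸩}
    (hx : ∀ i ∈ s, IsHomog ⊤ (c i) (x i)) (hy : ∀ i ∈ s, IsHomog ⊤ (c i) (y i))
    (h : ∑ i ∈ s, (-1 : ℤ) ^ e i • x i = ∑ i ∈ s, (-1 : ℤ) ^ e i • y i) :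
    ∀ i ∈ s, x i = y i := by
  rw [← sub_eq_zero, ← Finset.sum_sub_distrib] at h
  have hsub : ∀ i, (-1 : ℤ) ^ e i • x i - (-1 : ℤ) ^ e i • y i = (-1 : ℤ) ^ e i • (x i - y i) :=
    fun i => (zsmul_sub _ _ _).symm
  simp only [hsub] at h
  have h0 := homog_eq_zero_of_sum_eq_zero s hc (fun i hi => ?_) h
  · intro i hi
    have h1 := h0 i hi
    rcases neg_one_pow_eq_or ℤ (e i) with hs | hs
    · rw [hs, one_smul] at h1
      exact sub_eq_zero.mp h1
    · rw [hs, neg_one_smul, neg_eq_zero] at h1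
      exact sub_eq_zero.mp h1
  · have h1 := (hx i hi).sub (hy i hi)
    rcases neg_one_pow_eq_or ℤ (e i) with hs | hs
    · rw [hs, one_smul]; exact h1
    · rw [hs, neg_one_smul]; exact h1.neg

/-- The matrix `T(u) τ⁻¹`. -/
def opT (t : Fin n → Fin n → ℕ → A) : Matrix (Fin n) (Fin n) (Module.End ℂ A⸨X⸩) :=
  Matrix.of fun i j => mulOp (series (t i j)) * shift (-1)

theorem opT_isHomogPS (t : Fin n → Fin n → ℕ → A) (i j : Fin n) :
    IsHomogPS (-1) (t i j 0) (opT t i j) :=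
  ⟨PowerSeries.mk (t i j), rfl, by
    rw [← PowerSeries.coeff_zero_eq_constantCoeff_apply, PowerSeries.coeff_mk]⟩

/-- The constant terms of the columns form the identity matrix, so each single minor has constant
term 1. With `IsHomogPS.exists_inv` this makes minors invertible. -/
theorem minor_isHomogPS {t : Fin n → Fin n → ℕ → A}
    (ht : ∀ i j, t i j 0 = if i = j then 1 else 0) (K : Finset (Fin n)) :
    IsHomogPS (-(K.card : ℂ)) (1 : A) (minor K (opT t)) := by
  have h := IsHomogPS.cdet (d := fun j => if j ∈ K then (-1 : ℂ) else 0)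
    (m := (1 : Matrix (Fin n) (Fin n) A))
    (M := Matrix.of fun i j => if j ∈ K then opT t i j else if i = j then 1 else 0) (fun i j => by
      by_cases hj : j ∈ K
      · simp only [hj, if_true, Matrix.of_apply, Matrix.one_apply, ← ht]
        exact opT_isHomogPS t i j
      · by_cases hij : i = j
        · simp only [hj, hij, if_true, if_false, Matrix.of_apply, Matrix.one_apply]
          exact IsHomogPS.one
        · simp only [hj, hij, if_false, Matrix.of_apply, Matrix.one_apply]
          exact IsHomogPS.zero)
  rw [cdet_one] at h
  refine h.congr ?_
  simp

theorem minorSum_isHomogPS {t : Fin n → Fin n → ℕ → A}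
    (ht : ∀ i j, t i j 0 = if i = j then 1 else 0) (k : ℕ) :
    ∃ a : A, IsHomogPS (-(k : ℂ)) a (minorSum k (opT t)) := by
  refine Finset.sum_induction _ (fun x => ∃ a : A, IsHomogPS (-(k : ℂ)) a x)
    (fun x y ⟨a, ha⟩ ⟨b, hb⟩ => ⟨a + b, ha.add hb⟩) ⟨0, IsHomogPS.zero⟩ fun K hK => ⟨1, ?_⟩
  rw [← (Finset.mem_filter.mp hK).2]
  exact minor_isHomogPS ht K

theorem minorSum_intertwined {B : Type*} [Ring B] [Algebra ℂ B] (h : A →ₐ[ℂ] B)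
    (t : Fin n → Fin n → ℕ → A) (k : ℕ) :
    (minorSum k (opT t), minorSum k (opT fun i j r => h (t i j r))) ∈ intertwined h := by
  have hT : ∀ i j, (opT t i j, opT (fun i j r => h (t i j r)) i j) ∈ intertwined h := by
    intro i j
    have hs : (series (t i j)).map h = series fun r => h (t i j r) := by
      ext r
      rw [HahnSeries.map_coeff, series, series, PowerSeries.coeff_coe, PowerSeries.coeff_coe]
      split_ifs <;> simp
    have := (intertwined h).mul_mem (mulOp_intertwined h (series (t i j)))
      (shift_intertwined h (-1))
    rw [hs] at this
    exact this
  have hK : ∀ K, (minor K (opT t), minor K (opT fun i j r => h (t i j r))) ∈ intertwined h := by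
    refine fun K => cdet_intertwined h fun i j => ?_
    simp only [Matrix.of_apply]
    split_ifs
    · exact hT i j
    · exact (intertwined h).one_mem
    · exact (intertwined h).zero_mem
  have := (intertwined h).sum_mem (t := Finset.univ.filter fun K : Finset (Fin n) => K.card = k)
    fun K _ => hK K
  convert this using 1
  ext1
  · rw [Prod.fst_sum]; rfl
  · rw [Prod.snd_sum]; rfl

/-- The shifts between consecutive factors cancel, since the factor j ends with τ^{j+1} and the next
one starts with τ^{-(j+1)}. -/
theorem prod_conj_shift {k : ℕ} (x : Fin k → Module.End ℂ A⸨X⸩) :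
    (List.ofFn fun j : Fin k => shift (-((j : ℕ) : ℂ)) * x j * shift (((j : ℕ) : ℂ) + 1)).prod =
      (List.ofFn x).prod * shift (k : ℂ) := by
  induction k with
  | zero => simp [shift_zero]
  | succ k ih =>
    rw [List.ofFn_succ_last, List.ofFn_succ_last (f := x), List.prod_append, List.prod_append,
      List.prod_singleton, List.prod_singleton]
    have := ih fun j => x j.castSucc
    simp only [Fin.val_castSucc, Fin.val_last]
    rw [this, mul_assoc, ← mul_assoc (shift (k : ℂ)), ← mul_assoc (shift (k : ℂ)),
      shift_mul_shift, add_neg_cancel, shift_zero, one_mul, ← mul_assoc, Nat.cast_succ]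

/-- The arguments u - j + 1 in the definition of the Bethe operator are what is left after
telescoping powers of τ between the columns of 1 - T(u) τ⁻¹. In 0-based numbering, column j is
multiplied by τ^{-j} on the left and by τ^{j+1} on the right. -/
theorem diffOp_eq (n : ℕ) : diffOp (n := n) (fun _ => 1) =
    cdet (1 - opT (Yangian.t (n := n))) * shift (n : ℂ) := by
  have hD : ∀ i j : Fin n, opD (fun _ => 1) i j = shift (-((j : ℕ) : ℂ)) *
      (1 - opT (Yangian.t (n := n))) i j * shift (((j : ℕ) : ℂ) + 1) := by
    intro i j
    have h1 : shift (-((j : ℕ) : ℂ)) * (1 : Matrix (Fin n) (Fin n) (Module.End ℂ (Yangian n)⸨X⸩)) i j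
        * shift (((j : ℕ) : ℂ) + 1) = if i = j then (1 : ℂ) • tau else 0 := by
      rw [Matrix.one_apply]
      split_ifs
      · rw [mul_one, shift_mul_shift, neg_add_cancel_left, one_smul, tau]
      · rw [mul_zero, zero_mul]
    have h2 : shift (-((j : ℕ) : ℂ)) * opT (Yangian.t (n := n)) i j * shift (((j : ℕ) : ℂ) + 1) =
        mulOp (shift (-((j : ℕ) : ℂ)) (series (Yangian.t i j))) := by
      rw [opT, Matrix.of_apply, ← mul_assoc, shift_mul_mulOp, mul_assoc, mul_assoc,
        shift_mul_shift, shift_mul_shift]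
      have : -((j : ℕ) : ℂ) + (-1 + (((j : ℕ) : ℂ) + 1)) = 0 := by ring
      rw [this, shift_zero, mul_one]
    rw [Matrix.sub_apply, mul_sub, sub_mul, h1, h2, opD]
  rw [diffOp, cdet, Finset.sum_mul]
  refine Finset.sum_congr rfl fun σ _ => ?_
  simp only [hD]
  rw [prod_conj_shift fun j => (1 - opT (Yangian.t (n := n))) (σ j) j, smul_mul_assoc]

theorem diffOp_eq_sum (n : ℕ) : diffOp (n := n) (fun _ => 1) =
    ∑ i : Fin (n + 1), (-1 : ℤ) ^ (i : ℕ) •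
      (mulOp (minorSum i (opT (Yangian.t (n := n))) 1) * tau ^ (n - (i : ℕ))) := by
  rw [diffOp_eq, cdet_one_sub_eq_minorSum, Finset.sum_mul]
  refine Finset.sum_congr rfl fun i _ => ?_
  obtain ⟨a, ha⟩ := minorSum_isHomogPS (Yangian.isRTT n).zero i
  rw [smul_mul_assoc, ha.isHomog.eq_mulOp, mul_assoc, shift_mul_shift, tau_pow,
    mulOp_shift_apply_one, Nat.cast_sub (Nat.lt_succ_iff.mp i.2), neg_add_eq_sub]

/-- The summand of index i has degree n - i in τ, and operators of distinct degrees are independent,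
so the coefficient series can be compared one at a time. -/
theorem isBetheCoeff_iff {n : ℕ} (B : Fin (n + 1) → ℕ → Yangian n) :
    IsBetheCoeff (fun _ => 1) B ↔
      ∀ i : Fin (n + 1), series (B i) = minorSum i (opT (Yangian.t (n := n))) 1 := by
  constructor
  · intro h
    rw [IsBetheCoeff, diffOp_eq_sum] at h
    have hc : Function.Injective fun i : Fin (n + 1) => ((n - (i : ℕ) : ℕ) : ℂ) := by
      intro i j hij
      have := Nat.cast_injective hij
      ext
      omega
    have hz : ∀ (i : Fin (n + 1)) (f : (Yangian n)⸨X⸩), IsHomog ⊤ ((n - (i : ℕ) : ℕ) : ℂ)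
        (mulOp f * tau ^ (n - (i : ℕ))) := fun i f => ⟨f, fun _ => trivial, by rw [tau_pow]⟩
    intro i
    have hi := homog_eq_of_alternating_sum_eq Finset.univ (fun i : Fin (n + 1) => (i : ℕ)) hc
      (fun i _ => hz i _) (fun i _ => hz i _) h i (Finset.mem_univ i)
    have hi' := DFunLike.congr_fun hi 1
    rw [tau_pow, mulOp_shift_apply_one, mulOp_shift_apply_one] at hi'
    exact hi'.symm
  · intro h
    rw [IsBetheCoeff, diffOp_eq_sum]
    simp only [h]

/-- The image of the Bethe subalgebra is generated by the coefficients of the sums of principal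
minors of the image of `T(u) τ⁻¹`. -/
theorem map_betheAlgebra_le_iff (h : Yangian n →ₐ[ℂ] A) (S : Subalgebra ℂ A) :
    (betheAlgebra (n := n) fun _ => 1).map h ≤ S ↔
      ∀ k ≤ n, IsHomog S (-(k : ℂ)) (minorSum k (opT fun i j r => h (Yangian.t i j r))) := by
  have hmap : ∀ k, (minorSum k (opT fun i j r => h (Yangian.t i j r))) 1 =
      HahnSeries.map (minorSum k (opT (Yangian.t (n := n))) 1) h := by
    intro k
    have := minorSum_intertwined h (Yangian.t (n := n)) k 1
    rw [← this]
    congr 1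
    exact (HahnSeries.map_one (h : Yangian n →+* A).toMonoidWithZeroHom).symm
  have hhom : ∀ k : ℕ, IsHomog ⊤ (-(k : ℂ)) (minorSum k (opT fun i j r => h (Yangian.t i j r))) := by
    intro k
    obtain ⟨a, ha⟩ := minorSum_isHomogPS (t := fun i j r => h (Yangian.t i j r)) (fun i j => by
      rw [(Yangian.isRTT n).zero]; split_ifs <;> simp) k
    exact ha.isHomog
  rw [betheAlgebra, AlgHom.map_adjoin, Algebra.adjoin_le_iff]
  constructor
  · intro hS k hk
    rw [(hhom k).eq_mulOp]
    refine ⟨_, fun r => ?_, rfl⟩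
    choose a ha using fun i : Fin (n + 1) => minorSum_isHomogPS (Yangian.isRTT n).zero (i : ℕ)
    choose g hg using ha
    -- Sums of minors are power series in u⁻¹, so a family of Bethe coefficients exists, and its
    -- members lie in the generating set.
    have hB : IsBetheCoeff (fun _ => 1) fun i j => PowerSeries.coeff j (g i) := by
      rw [isBetheCoeff_iff]
      intro i
      rw [(hg i).1, mulOp_shift_apply_one, series]
      congr 1
      ext j
      rw [PowerSeries.coeff_mk]
    rw [hmap, HahnSeries.map_coeff]
    have h1 := (isBetheCoeff_iff _).mp hB ⟨k, Nat.lt_succ_of_le hk⟩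
    rw [← h1, series, PowerSeries.coeff_coe]
    split_ifs
    · rw [map_zero]; exact S.zero_mem
    · rw [PowerSeries.coeff_mk]
      exact hS ⟨_, ⟨_, hB, _, _, rfl⟩, rfl⟩
  · rintro hS _ ⟨_, ⟨B, hB, i, j, rfl⟩, rfl⟩
    have h1 := (hS i (Nat.lt_succ_iff.mp i.2)).coeff_mem j
    rw [hmap, ← (isBetheCoeff_iff B).mp hB i, HahnSeries.map_coeff, series] at h1
    simpa using h1

end Bethe

/-! ### The matrix `(1 + E u⁻¹) τ⁻¹` over `U(gl_N)` -/

section ManinCriterion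

variable {R : Type*} [Ring R] {N : ℕ}

/-- The `gl_N` relations make `δ_ij a + e_ij b` a Manin matrix when `[a, b] = b²`. -/
theorem isManin_of_gl {E : Fin N → Fin N → R} {a b : R}
    (hE : ∀ i j k l, E i j * E k l - E k l * E i j =
      (if k = j then E i l else 0) - (if i = l then E k j else 0))
    (ha : ∀ i j, a * E i j = E i j * a) (hb : ∀ i j, b * E i j = E i j * b)
    (hab : a * b - b * a = b * b) :
    IsManin (Matrix.of fun i j => (if i = j then a else 0) + E i j * b) := by
  -- Here d₁ and d₂ stand for δ_ij and δ_kl. With the gl_N relations inserted, the factor before b²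
  -- becomes δ_ij E_kl - δ_kl E_ij + δ_kj E_il - δ_il E_kj, which is invariant under exchanging i
  -- and k; that invariance is the Manin relation.
  have hcomm : ∀ (d₁ d₂ : ℤ) (i j k l : Fin N),
      (d₁ • a + E i j * b) * (d₂ • a + E k l * b) - (d₂ • a + E k l * b) * (d₁ • a + E i j * b) =
        (d₁ • E k l - d₂ • E i j + (E i j * E k l - E k l * E i j)) * (b * b) := by
    intro d₁ d₂ i j k l
    have h1 : ∀ i j k l, E i j * b * (E k l * b) = E i j * E k l * (b * b) := by
      intro i j k l
      rw [mul_assoc, ← mul_assoc b, hb]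
      simp only [mul_assoc]
    have h2 : ∀ i j, a * (E i j * b) = E i j * (b * a) + E i j * (b * b) := by
      intro i j
      rw [← mul_assoc, ha, mul_assoc, ← mul_add, ← hab, add_sub_cancel]
    simp only [mul_add, add_mul, sub_mul, smul_mul_assoc, mul_smul_comm, h1, h2, smul_add]
    rw [smul_comm d₂ d₁]
    simp only [mul_assoc]
    abel
  have hδ : ∀ i j : Fin N, (if i = j then a else 0) = (if i = j then (1 : ℤ) else 0) • a := by
    intro i j
    split_ifs <;> simp
  have hE' : ∀ i j k l, E i j * E k l - E k l * E i j =
      (if k = j then (1 : ℤ) else 0) • E i l - (if i = l then (1 : ℤ) else 0) • E k j := by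
    intro i j k l
    rw [hE]
    split_ifs <;> simp
  intro i j k l
  simp only [Matrix.of_apply, hδ]
  rw [hcomm, hcomm, hE', hE']
  congr 1
  abel

end ManinCriterion

section Ugl

variable {N : ℕ}

/-- The shift-invariant operators of left multiplication by elements of the coefficient ring. -/
def constOp {A : Type*} [Ring A] [Algebra ℂ A] (x : A) : Module.End ℂ A⸨X⸩ :=
  mulOp (HahnSeries.C x)

section Const

variable {A : Type*} [Ring A] [Algebra ℂ A]

theorem constOp_mul (x y : A) : constOp (x * y) = constOp x * constOp y := by
  rw [constOp, constOp, constOp, mulOp_mul_mulOp, map_mul]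

theorem constOp_add (x y : A) : constOp (x + y) = constOp x + constOp y := by
  rw [constOp, constOp, constOp, map_add, mulOp_add]

theorem constOp_zero : constOp (0 : A) = 0 := by
  rw [constOp, map_zero, mulOp_zero]

theorem constOp_sub (x y : A) : constOp (x - y) = constOp x - constOp y :=
  eq_sub_of_add_eq (by rw [← constOp_add, sub_add_cancel])

theorem shift_mul_constOp (c : ℂ) (x : A) : shift c * constOp x = constOp x * shift c := by
  rw [constOp, shift_mul_mulOp, shift_C]

/-- The operator `u⁻¹ τ⁻¹`. -/
def opW (A : Type*) [Ring A] [Algebra ℂ A] : Module.End ℂ A⸨X⸩ := mulOp (seriesW A) * shift (-1)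

/-- The operator `τ u`, inverse to `u⁻¹ τ⁻¹`. -/
def opTheta (A : Type*) [Ring A] [Algebra ℂ A] : Module.End ℂ A⸨X⸩ := shift 1 * mulOp (seriesU A)

theorem opW_mul_constOp (x : A) : opW A * constOp x = constOp x * opW A := by
  rw [opW, mul_assoc, shift_mul_constOp, ← mul_assoc, ← mul_assoc]
  congr 1
  rw [constOp, mulOp_mul_mulOp, mulOp_mul_mulOp, seriesW_comm]

theorem opTheta_mul_constOp (x : A) : opTheta A * constOp x = constOp x * opTheta A := by
  rw [opTheta, ← mul_assoc, ← shift_mul_constOp, mul_assoc, mul_assoc]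
  congr 1
  rw [constOp, mulOp_mul_mulOp, mulOp_mul_mulOp, seriesU_comm]

theorem opTheta_mul_opW : opTheta A * opW A = 1 := by
  rw [opTheta, opW, mul_assoc, ← mul_assoc (mulOp _), mulOp_mul_mulOp, seriesU_mul_seriesW,
    mulOp_one, one_mul, shift_mul_shift, add_neg_cancel, shift_zero]

theorem opW_mul_opTheta : opW A * opTheta A = 1 := by
  rw [opTheta, opW, mul_assoc, ← mul_assoc (shift _), shift_mul_shift, neg_add_cancel, shift_zero,
    one_mul, mulOp_mul_mulOp, seriesW_mul_seriesU, mulOp_one]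

/-- This is τ u τ⁻¹ = u + 1: the operators τ u and τ⁻¹ form a canonical pair. Multiplying by u⁻¹ τ⁻¹
= (τ u)⁻¹ on both sides yields the relation [a, b] = b² needed for the Manin property. -/
theorem opTheta_shift_commutator : opTheta A * shift (-1) - shift (-1) * opTheta A = 1 := by
  rw [opTheta, ← mul_assoc (shift (-1)), shift_mul_shift, neg_add_cancel, shift_zero, one_mul,
    shift_mul_mulOp, mul_assoc, shift_mul_shift, add_neg_cancel, shift_zero, mul_one,
    shift_seriesU, mulOp_add, map_one, mulOp_one, add_sub_cancel_left]

theorem shift_opW_commutator : shift (-1) * opW A - opW A * shift (-1) = opW A * opW A := by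
  calc shift (-1) * opW A - opW A * shift (-1)
      = (opW A * opTheta A) * (shift (-1) * opW A) -
          (opW A * shift (-1)) * (opTheta A * opW A) := by
        rw [opW_mul_opTheta, opTheta_mul_opW, one_mul, mul_one]
    _ = opW A * (opTheta A * shift (-1) - shift (-1) * opTheta A) * opW A := by
        rw [mul_sub, sub_mul]
        simp only [mul_assoc]
    _ = opW A * opW A := by rw [opTheta_shift_commutator, mul_one]

theorem opTheta_isHomog (S : Subalgebra ℂ A) : IsHomog S 1 (opTheta A) := by
  have := (IsHomog.of_shift S 1).mul (IsHomog.of_mulOp (S := S) (f := seriesU A)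
    fun r => coeff_single_one_mem S _ r)
  rwa [add_zero] at this

end Const

/-- The matrix `(1 + E u⁻¹) τ⁻¹`. -/
abbrev capelli (N : ℕ) : Matrix (Fin N) (Fin N) (Module.End ℂ (Ugl N)⸨X⸩) := opT (evFamily N)

theorem series_evFamily (i j : Fin N) : series (evFamily N i j) =
    (if i = j then 1 else 0) + HahnSeries.C (e i j) * seriesW (Ugl N) := by
  have h : PowerSeries.mk (evFamily N i j) =
      (if i = j then 1 else 0) + PowerSeries.C (e i j) * PowerSeries.X := by
    ext r
    rcases r with _ | _ | r
    · split_ifs with hij <;> simp [evFamily, hij]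
    · split_ifs <;> simp [evFamily, PowerSeries.coeff_one]
    · split_ifs <;> simp [evFamily, PowerSeries.coeff_one]
  rw [series, h, map_add, map_mul, HahnSeries.ofPowerSeries_C, HahnSeries.ofPowerSeries_X]
  congr 1
  split_ifs
  · exact map_one _
  · exact map_zero _

theorem capelli_apply (i j : Fin N) : capelli N i j =
    (if i = j then shift (-1) else 0) + constOp (e i j) * opW (Ugl N) := by
  rw [capelli, opT, Matrix.of_apply, series_evFamily, mulOp_add, add_mul, ← mulOp_mul_mulOp,
    mul_assoc]
  congr 1
  split_ifs
  · rw [mulOp_one, one_mul]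
  · rw [mulOp_zero, zero_mul]

theorem constOp_e_commutator (i j k l : Fin N) :
    constOp (e i j) * constOp (e k l) - constOp (e k l) * constOp (e i j) =
      (if k = j then constOp (e i l) else 0) - (if i = l then constOp (e k j) else 0) := by
  rw [← constOp_mul, ← constOp_mul, ← constOp_sub, e_commutator, constOp_sub]
  split_ifs <;> simp only [constOp_zero]

theorem capelli_isManin (N : ℕ) : IsManin (capelli N) := by
  have h := isManin_of_gl constOp_e_commutator
    (fun i j => shift_mul_constOp (-1) (e (N := N) i j))
    (fun i j => opW_mul_constOp (e (N := N) i j)) shift_opW_commutator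
  have heq : capelli N = Matrix.of fun i j =>
      (if i = j then shift (-1) else 0) + constOp (e i j) * opW (Ugl N) := by
    ext1 i j
    exact capelli_apply i j
  rw [heq]
  exact h

/-- The commutator with a fixed element. -/
def adHom {R : Type*} [Ring R] (z : R) : R →+ R :=
  AddMonoidHom.mulLeft z - AddMonoidHom.mulRight z

theorem adHom_apply {R : Type*} [Ring R] (z x : R) : adHom z x = z * x - x * z := rfl

theorem adHom_mul {R : Type*} [Ring R] (z x y : R) :
    adHom z (x * y) = adHom z x * y + x * adHom z y := by
  simp only [adHom_apply, mul_sub, sub_mul, mul_assoc]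
  abel

/-- The term e_ij u⁻¹ τ⁻¹ commutes with τ u, because τ u is inverse to u⁻¹ τ⁻¹ and commutes with
e_ij; only δ_ij τ⁻¹ contributes. Thus the commutator with τ u removes one row and the corresponding
column from principal minors. -/
theorem adHom_opTheta_capelli (i j : Fin N) :
    adHom (opTheta (Ugl N)) (capelli N i j) = if i = j then 1 else 0 := by
  rw [adHom_apply, capelli_apply, mul_add, add_mul, ← mul_assoc, opTheta_mul_constOp, mul_assoc,
    mul_assoc, opTheta_mul_opW, opW_mul_opTheta, add_sub_add_right_eq_sub]
  split_ifs
  · exact opTheta_shift_commutator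
  · rw [mul_zero, zero_mul, sub_zero]

theorem adHom_e_capelli (a b i j : Fin N) : adHom (constOp (e a b)) (capelli N i j) =
    (if i = b then capelli N a j else 0) - (if j = a then capelli N i b else 0) := by
  have h1 : adHom (constOp (e a b)) (capelli N i j) =
      (constOp (e a b) * constOp (e i j) - constOp (e i j) * constOp (e a b)) * opW (Ugl N) := by
    rw [adHom_apply, capelli_apply, mul_add, add_mul, ← mul_assoc, mul_assoc (constOp (e i j)),
      opW_mul_constOp, ← mul_assoc, sub_mul]
    split_ifs
    · rw [shift_mul_constOp, add_sub_add_left_eq_sub]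
    · rw [mul_zero, zero_mul, zero_add, zero_add]
  rw [h1, constOp_e_commutator, sub_mul, capelli_apply, capelli_apply]
  rcases eq_or_ne i b with rfl | hib <;> rcases eq_or_ne j a with rfl | hja
  · simp
  · simp [hja, hja.symm]
  · simp [hib]
  · simp [hib, hja, hja.symm]

/-- The universal property gives a homomorphism from U(gl_N) to S whose composite with the inclusion
fixes the generators, hence is the identity. -/
theorem adjoin_e (S : Subalgebra ℂ (Ugl N)) (h : ∀ i j, e i j ∈ S) : S = ⊤ := by
  have hι : ∀ x, UniversalEnvelopingAlgebra.ι ℂ x ∈ S := by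
    intro x
    rw [Matrix.matrix_eq_sum_single x, map_sum]
    refine S.sum_mem fun i _ => ?_
    rw [map_sum]
    refine S.sum_mem fun j _ => ?_
    have : Matrix.single i j (x i j) = x i j • Matrix.single i j (1 : ℂ) := by simp
    rw [this, map_smul]
    exact S.smul_mem (h i j) _
  let f : Matrix (Fin N) (Fin N) ℂ →ₗ⁅ℂ⁆ S :=
    { toFun := fun x => ⟨UniversalEnvelopingAlgebra.ι ℂ x, hι x⟩
      map_add' := fun x y => Subtype.ext (map_add _ _ _)
      map_smul' := fun a x => Subtype.ext (map_smul _ _ _)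
      map_lie' := fun {x y} => Subtype.ext ((UniversalEnvelopingAlgebra.ι ℂ).map_lie x y) }
  have hid : S.val.comp (UniversalEnvelopingAlgebra.lift ℂ f) = AlgHom.id ℂ _ := by
    apply UniversalEnvelopingAlgebra.hom_ext
    ext1 x
    change S.val (UniversalEnvelopingAlgebra.lift ℂ f (UniversalEnvelopingAlgebra.ι ℂ x)) = _
    rw [UniversalEnvelopingAlgebra.lift_ι_apply]
    rfl
  refine eq_top_iff.mpr fun x _ => ?_
  have := DFunLike.congr_fun hid x
  rw [AlgHom.id_apply] at this
  rw [← this]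
  exact Subtype.prop _

theorem mem_center_of_commute_e {x : Ugl N} (h : ∀ i j, e i j * x = x * e i j) :
    x ∈ Subalgebra.center ℂ (Ugl N) := by
  have := adjoin_e (Subalgebra.centralizer ℂ {x}) fun i j => by
    rw [Subalgebra.mem_centralizer_iff]
    rintro _ rfl
    exact (h i j).symm
  rw [Subalgebra.mem_center_iff]
  intro b
  have hb : b ∈ Subalgebra.centralizer ℂ {x} := by rw [this]; trivial
  exact ((Subalgebra.mem_centralizer_iff ℂ).mp hb x rfl).symm

/-- The commutator with e_ij acts on the rows and columns of the matrix like a matrix unit, so it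
kills the column determinant. As e_ij commutes with shifts, this passes to each coefficient, and
commuting with all e_ij means being central. -/
theorem cdet_capelli_isHomog_center (N : ℕ) :
    IsHomog (Subalgebra.center ℂ (Ugl N)) (-(N : ℂ)) (cdet (capelli N)) := by
  have h := IsHomogPS.cdet (opT_isHomogPS (evFamily N))
  rw [Finset.sum_const, Finset.card_univ, Fintype.card_fin, nsmul_eq_mul, mul_neg, mul_one] at h
  obtain ⟨f, -, hf⟩ := h.isHomog
  refine ⟨f, fun r => mem_center_of_commute_e fun i j => ?_, hf⟩
  have h0 := (capelli_isManin N).derivation_cdet_eq_zero (adHom (constOp (e i j))) (adHom_mul _) i j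
    (adHom_e_capelli i j)
  rw [adHom_apply, sub_eq_zero] at h0
  change constOp (e i j) * cdet (opT (evFamily N)) = cdet (opT (evFamily N)) * constOp (e i j) at h0
  rw [hf, mul_assoc, shift_mul_constOp, ← mul_assoc, ← mul_assoc, constOp, mulOp_mul_mulOp,
    mulOp_mul_mulOp] at h0
  have h1 := DFunLike.congr_fun h0 1
  rw [mulOp_shift_apply_one, mulOp_shift_apply_one] at h1
  have h2 := congrArg (fun g => HahnSeries.coeff g r) h1
  simp only [HahnSeries.C_apply, HahnSeries.coeff_single_zero_mul,
    HahnSeries.coeff_mul_single_zero] at h2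
  exact h2

end Ugl

/-! ### Sums of principal minors of a given type -/

section TypedMinors

variable {N : ℕ} (I : Finset (Fin N))

/-- The subsets with `a` elements in `I` and `b` elements outside of `I`. -/
def typedSubsets (a b : ℕ) : Finset (Finset (Fin N)) :=
  Finset.univ.filter fun K => (K ∩ I).card = a ∧ (K ∩ Iᶜ).card = b

theorem mem_typedSubsets {a b : ℕ} {K : Finset (Fin N)} :
    K ∈ typedSubsets I a b ↔ (K ∩ I).card = a ∧ (K ∩ Iᶜ).card = b := by
  simp [typedSubsets]

theorem typedSubsets_compl (a b : ℕ) : typedSubsets Iᶜ a b = typedSubsets I b a := by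
  ext K
  rw [mem_typedSubsets, mem_typedSubsets, compl_compl, and_comm]

theorem card_of_mem_typedSubsets {a b : ℕ} {K : Finset (Fin N)} (hK : K ∈ typedSubsets I a b) :
    K.card = a + b := by
  obtain ⟨rfl, rfl⟩ := (mem_typedSubsets I).mp hK
  rw [← Finset.card_union_of_disjoint, ← Finset.inter_union_distrib_left, Finset.union_compl,
    Finset.inter_univ]
  exact (disjoint_compl_right (a := I)).mono Finset.inter_subset_right Finset.inter_subset_right

/-- Double counting: a set L of type (a, b) is obtained by erasing t from L ∪ {t}, once for each of
the |I| - a elements t of I outside L. -/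
theorem sum_erase_typedSubsets {G : Type*} [AddCommGroup G] (f : Finset (Fin N) → G) (a b : ℕ) :
    ∑ K ∈ typedSubsets I (a + 1) b, ∑ t ∈ K ∩ I, f (K.erase t) =
      (I.card - a) • ∑ K ∈ typedSubsets I a b, f K := by
  have h : ∀ L ∈ typedSubsets I a b, (I.card - a) • f L = ∑ t ∈ I \ L, f L := by
    intro L hL
    rw [Finset.sum_const, ← ((mem_typedSubsets I).mp hL).1, Finset.card_sdiff]
  rw [Finset.smul_sum, Finset.sum_congr rfl h, Finset.sum_sigma', Finset.sum_sigma']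
  refine Finset.sum_bij' (fun x _ => ⟨x.1.erase x.2, x.2⟩) (fun x _ => ⟨insert x.2 x.1, x.2⟩)
    ?_ ?_ ?_ ?_ ?_
  · rintro ⟨K, t⟩ hK
    obtain ⟨hK, ht⟩ := Finset.mem_sigma.mp hK
    obtain ⟨htK, htI⟩ := Finset.mem_inter.mp ht
    obtain ⟨h1, h2⟩ := (mem_typedSubsets I).mp hK
    refine Finset.mem_sigma.mpr ⟨(mem_typedSubsets I).mpr ⟨?_, ?_⟩, by simp [htI]⟩
    · rw [Finset.erase_inter, Finset.card_erase_of_mem ht, h1, Nat.add_sub_cancel]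
    · rw [Finset.erase_inter, Finset.erase_eq_of_notMem (by simp [htI]), h2]
  · rintro ⟨L, t⟩ hL
    obtain ⟨hL, ht⟩ := Finset.mem_sigma.mp hL
    obtain ⟨htI, htL⟩ := Finset.mem_sdiff.mp ht
    obtain ⟨h1, h2⟩ := (mem_typedSubsets I).mp hL
    refine Finset.mem_sigma.mpr ⟨(mem_typedSubsets I).mpr ⟨?_, ?_⟩, by simp [htI]⟩
    · rw [Finset.insert_inter_of_mem htI, Finset.card_insert_of_notMem (by simp [htL]), h1]
    · rw [Finset.insert_inter_of_notMem (by simp [htI]), h2]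
  · rintro ⟨K, t⟩ hK
    have := (Finset.mem_inter.mp (Finset.mem_sigma.mp hK).2).1
    simp [Finset.insert_erase this]
  · rintro ⟨L, t⟩ hL
    have := (Finset.mem_sdiff.mp (Finset.mem_sigma.mp hL).2).2
    simp [Finset.erase_insert this]
  · rintro ⟨K, t⟩ _
    rfl

/-- The sum of the principal minors with `a` rows in `I` and `b` rows outside of `I`. -/
def typedMinorSum {R : Type*} [Ring R] (M : Matrix (Fin N) (Fin N) R) (a b : ℕ) : R :=
  ∑ K ∈ typedSubsets I a b, minor K M

theorem typedMinorSum_compl {R : Type*} [Ring R] (M : Matrix (Fin N) (Fin N) R) (a b : ℕ) :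
    typedMinorSum Iᶜ M a b = typedMinorSum I M b a := by
  rw [typedMinorSum, typedSubsets_compl, typedMinorSum]

/-- The derivation deletes one index of K at a time. Deleting outside I is counted here; deleting
inside I is left as a sum, because its closed form involves a - 1 and is empty for a = 0. -/
theorem derivation_typedMinorSum {R : Type*} [Ring R] {M : Matrix (Fin N) (Fin N) R} (δ : R →+ R)
    (hδ : ∀ x y, δ (x * y) = δ x * y + x * δ y) (h : ∀ i j, δ (M i j) = if i = j then 1 else 0)
    (a b : ℕ) : δ (typedMinorSum I M a (b + 1)) = (Iᶜ.card - b) • typedMinorSum I M a b +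
      ∑ K ∈ typedSubsets I a (b + 1), ∑ t ∈ K ∩ I, minor (K.erase t) M := by
  have h1 := sum_erase_typedSubsets Iᶜ (fun K => minor K M) b a
  rw [typedSubsets_compl, typedSubsets_compl] at h1
  rw [typedMinorSum, map_sum, typedMinorSum, ← h1, ← Finset.sum_add_distrib]
  refine Finset.sum_congr rfl fun K _ => ?_
  rw [derivation_minor δ hδ h, ← Finset.sum_union, ← Finset.inter_union_distrib_left,
    Finset.union_comm, Finset.union_compl, Finset.inter_univ]
  exact (disjoint_compl_left (a := I)).mono Finset.inter_subset_right Finset.inter_subset_right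

theorem typedSubsets_card_compl (a : ℕ) (K : Finset (Fin N)) :
    K ∈ typedSubsets I a Iᶜ.card ↔ Iᶜ ⊆ K ∧ (K ∩ I).card = a := by
  rw [mem_typedSubsets, and_comm]
  refine and_congr_left fun _ => ⟨fun h => ?_, fun h => by rw [Finset.inter_eq_right.mpr h]⟩
  exact Finset.inter_eq_right.mp (Finset.eq_of_subset_of_card_le Finset.inter_subset_right h.ge)

theorem typedMinorSum_card_compl_zero {R : Type*} [Ring R] (M : Matrix (Fin N) (Fin N) R) :
    typedMinorSum I M 0 Iᶜ.card = minor Iᶜ M := by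
  have : typedSubsets I 0 Iᶜ.card = {Iᶜ} := by
    ext K
    rw [typedSubsets_card_compl, Finset.mem_singleton, Finset.card_eq_zero,
      ← Finset.disjoint_iff_inter_eq_empty]
    constructor
    · rintro ⟨h1, h2⟩
      exact (Finset.subset_compl_iff_disjoint_right.mpr h2).antisymm h1
    · rintro rfl
      exact ⟨subset_rfl, disjoint_compl_left⟩
  rw [typedMinorSum, this, Finset.sum_singleton]

theorem minor_univ {R : Type*} [Ring R] (M : Matrix (Fin N) (Fin N) R) :
    minor Finset.univ M = cdet M := by
  rw [minor]
  congr 1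
  ext i j
  simp

theorem typedMinorSum_card_card {R : Type*} [Ring R] (M : Matrix (Fin N) (Fin N) R) :
    typedMinorSum I M I.card Iᶜ.card = cdet M := by
  have : typedSubsets I I.card Iᶜ.card = {Finset.univ} := by
    ext K
    rw [typedSubsets_card_compl, Finset.mem_singleton]
    constructor
    · rintro ⟨h1, h2⟩
      have h3 : I ⊆ K := Finset.inter_eq_right.mp
        (Finset.eq_of_subset_of_card_le Finset.inter_subset_right h2.ge)
      refine Finset.eq_univ_of_forall fun x => ?_
      by_cases hx : x ∈ I
      · exact h3 hx
      · exact h1 (Finset.mem_compl.mpr hx)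
    · rintro rfl
      simp
  rw [typedMinorSum, this, Finset.sum_singleton, minor_univ]

theorem minorSum_zero {R : Type*} [Ring R] (M : Matrix (Fin N) (Fin N) R) : minorSum 0 M = 1 := by
  have : (Finset.univ.filter fun K : Finset (Fin N) => K.card = 0) = {∅} := by
    ext K
    simp
  rw [minorSum, this, Finset.sum_singleton, minor, ← cdet_one (k := N) (R := R)]
  congr 1
  ext i j
  rw [Matrix.of_apply, if_neg (Finset.notMem_empty j), Matrix.one_apply, cdet_one]

theorem minorSum_card {R : Type*} [Ring R] (M : Matrix (Fin N) (Fin N) R) :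
    minorSum N M = cdet M := by
  have : (Finset.univ.filter fun K : Finset (Fin N) => K.card = N) = {Finset.univ} := by
    ext K
    rw [Finset.mem_filter, Finset.mem_singleton, ← Finset.card_eq_iff_eq_univ, Fintype.card_fin]
    simp
  rw [minorSum, this, Finset.sum_singleton, minor_univ]

theorem cdet_diagonal_sub_eq_typedMinorSum {R : Type*} [Ring R] (M : Matrix (Fin N) (Fin N) R) :
    cdet (Matrix.of fun i j => (if i = j ∧ j ∈ I then 1 else 0) - M i j) =
      ∑ k : Fin (I.card + 1), (-1 : ℤ) ^ (k : ℕ) • (-1 : ℤ) ^ Iᶜ.card •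
        typedMinorSum I M k Iᶜ.card := by
  rw [cdet_diagonal_sub, Fin.sum_univ_eq_sum_range
    (fun k => (-1 : ℤ) ^ k • (-1 : ℤ) ^ Iᶜ.card • typedMinorSum I M k Iᶜ.card) (I.card + 1),
    ← Finset.sum_fiberwise_of_maps_to (g := fun K => (K ∩ I).card)
      (t := Finset.range (I.card + 1))]
  · refine Finset.sum_congr rfl fun k _ => ?_
    have : (Finset.univ.filter fun K => Iᶜ ⊆ K).filter (fun K => (K ∩ I).card = k) =
        typedSubsets I k Iᶜ.card := by
      ext K
      rw [typedSubsets_card_compl]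
      simp
    rw [this, typedMinorSum, Finset.smul_sum, Finset.smul_sum]
    refine Finset.sum_congr rfl fun K hK => ?_
    rw [smul_smul, ← pow_add, card_of_mem_typedSubsets I hK]
  · intro K _
    have := Finset.card_le_card (Finset.inter_subset_right (s₁ := K) (s₂ := I))
    exact Finset.mem_range.mpr (by omega)

theorem typedMinorSum_isHomogPS {A : Type*} [Ring A] [Algebra ℂ A] {t : Fin N → Fin N → ℕ → A}
    (ht : ∀ i j, t i j 0 = if i = j then 1 else 0) (a b : ℕ) :
    ∃ c : A, IsHomogPS (-((a : ℂ) + b)) c (typedMinorSum I (opT t) a b) := by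
  refine Finset.sum_induction _ (fun x => ∃ c : A, IsHomogPS (-((a : ℂ) + b)) c x)
    (fun x y ⟨c, hc⟩ ⟨d, hd⟩ => ⟨c + d, hc.add hd⟩) ⟨0, IsHomogPS.zero⟩ fun K hK => ⟨1, ?_⟩
  rw [← Nat.cast_add, ← card_of_mem_typedSubsets I hK]
  exact minor_isHomogPS ht K

/-- The sums of minors of all types have coefficients in a subalgebra as soon as those containing
all of `Iᶜ` do. -/
theorem typedMinorSum_isHomog_of_top {S : Subalgebra ℂ (Ugl N)}
    (h : ∀ a : ℕ, IsHomog S (-((a : ℂ) + (Iᶜ.card : ℂ))) (typedMinorSum I (capelli N) a Iᶜ.card))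
    (b : ℕ) (hb : b ≤ Iᶜ.card) (a : ℕ) :
    IsHomog S (-((a : ℂ) + b)) (typedMinorSum I (capelli N) a b) := by
  induction hb using Nat.decreasingInduction generalizing a with
  | self => exact h a
  | of_succ b hb ih =>
    have hd := derivation_typedMinorSum I (adHom (opTheta (Ugl N))) (adHom_mul _)
      adHom_opTheta_capelli a b
    have h1 : IsHomog S (-((a : ℂ) + b))
        (adHom (opTheta (Ugl N)) (typedMinorSum I (capelli N) a (b + 1))) := by
      rw [adHom_apply]
      refine (((opTheta_isHomog S).mul (ih a)).congr ?_).sub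
        (((ih a).mul (opTheta_isHomog S)).congr ?_) <;> push_cast <;> ring
    -- This is a multiple of the sum of type (a - 1, b + 1), already available because the induction
    -- on b covers all a at once; for a = 0 it is empty.
    have h2 : IsHomog S (-((a : ℂ) + b)) (∑ K ∈ typedSubsets I a (b + 1), ∑ t ∈ K ∩ I,
        minor (K.erase t) (capelli N)) := by
      cases a with
      | zero =>
        rw [Finset.sum_eq_zero]
        · exact IsHomog.zero
        · intro K hK
          rw [Finset.card_eq_zero.mp ((mem_typedSubsets I).mp hK).1, Finset.sum_empty]
      | succ a =>
        rw [sum_erase_typedSubsets I (fun K => minor K (capelli N)), ← Nat.cast_smul_eq_nsmul ℂ]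
        refine ((ih a).smul _).congr ?_
        push_cast
        ring
    -- The factor |Iᶜ| - b is invertible in ℂ because b < |Iᶜ|.
    have h3 := (h1.sub h2).smul (((Iᶜ.card - b : ℕ) : ℂ)⁻¹)
    rw [hd, add_sub_cancel_right, ← Nat.cast_smul_eq_nsmul ℂ, smul_smul, inv_mul_cancel₀,
      one_smul] at h3
    · exact h3
    · exact Nat.cast_ne_zero.mpr (by omega)

end TypedMinors

/-! ### Schur complements and the image of the Bethe subalgebra -/

theorem IsManin.diagonal_sub {ι R : Type*} [Ring R] {M d : Matrix ι ι R} (hM : IsManin M)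
    (hd : ∀ i j x, d i j * x = x * d i j) : IsManin (Matrix.of fun i j => d i j - M i j) := by
  have h : ∀ i j k l, (d i j - M i j) * (d k l - M k l) - (d k l - M k l) * (d i j - M i j) =
      M i j * M k l - M k l * M i j := by
    intro i j k l
    rw [mul_sub, sub_mul, sub_mul, mul_sub, sub_mul, sub_mul, hd i j, hd i j, hd k l (M i j)]
    abel
  intro i j k l
  simp only [Matrix.of_apply]
  rw [h, h, hM]

section Schur

variable {N p r : ℕ} (e : Fin p ⊕ Fin r ≃ Fin N)

/-- The indices of the first block. -/
def firstBlock : Finset (Fin N) := Finset.univ.map (Function.Embedding.inl.trans e.toEmbedding)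

theorem inl_mem_firstBlock (i : Fin p) : e (.inl i) ∈ firstBlock e :=
  Finset.mem_map.mpr ⟨i, Finset.mem_univ _, rfl⟩

theorem inr_notMem_firstBlock (i : Fin r) : e (.inr i) ∉ firstBlock e := by
  intro h
  obtain ⟨j, -, hj⟩ := Finset.mem_map.mp h
  exact absurd (e.injective hj) (by simp)

theorem card_firstBlock : (firstBlock e).card = p := by
  rw [firstBlock, Finset.card_map, Finset.card_univ, Fintype.card_fin]

theorem firstBlock_compl :
    (firstBlock e)ᶜ = firstBlock ((Equiv.sumComm (Fin r) (Fin p)).trans e) := by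
  ext x
  obtain ⟨y, rfl⟩ := e.surjective x
  rw [Finset.mem_compl]
  rcases y with i | i
  · have h := inr_notMem_firstBlock ((Equiv.sumComm (Fin r) (Fin p)).trans e) i
    have h' : ((Equiv.sumComm (Fin r) (Fin p)).trans e) (Sum.inr i) = e (.inl i) := rfl
    rw [h'] at h
    simp [h, inl_mem_firstBlock]
  · have h := inl_mem_firstBlock ((Equiv.sumComm (Fin r) (Fin p)).trans e) i
    have h' : ((Equiv.sumComm (Fin r) (Fin p)).trans e) (Sum.inl i) = e (.inr i) := rfl
    rw [h'] at h
    simp [h, inr_notMem_firstBlock]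

theorem card_firstBlock_compl : (firstBlock e)ᶜ.card = r := by
  rw [firstBlock_compl, card_firstBlock]

/-- `t'(u) = A - B D⁻¹ C` for the blocks of the matrix `t(u)`, where `K` stands for `D⁻¹ C`. -/
def IsSchurComplement {A : Type*} [Ring A] (t : Fin N → Fin N → ℕ → A)
    (t' : Fin p → Fin p → ℕ → A) : Prop :=
  ∃ K : Fin r → Fin p → A⸨X⸩,
    (∀ i j, series (t (e (.inl i)) (e (.inl j))) =
      series (t' i j) + ∑ k, series (t (e (.inl i)) (e (.inr k))) * K k j) ∧
    ∀ i j, series (t (e (.inr i)) (e (.inl j))) =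
      ∑ k, series (t (e (.inr i)) (e (.inr k))) * K k j

variable {e}

/-- With the second block placed first, the matrix J - M has leading block -D, and the Schur
complement of this block is (1 - A) + B D⁻¹ C, that is, 1 minus the Schur complement of M. Moving
the blocks is harmless because J - M is again Manin. -/
theorem IsSchurComplement.cdet_eq {A : Type*} [Ring A] [Algebra ℂ A] {t : Fin N → Fin N → ℕ → A}
    {t' : Fin p → Fin p → ℕ → A} (h : IsSchurComplement e t t') (hM : IsManin (opT t)) :
    cdet (Matrix.of fun i j => (if i = j ∧ j ∈ firstBlock e then 1 else 0) - opT t i j) =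
      cdet (Matrix.of fun i j => -opT t (e (.inr i)) (e (.inr j))) * cdet (1 - opT t') := by
  obtain ⟨K, hK1, hK2⟩ := h
  set P : Matrix (Fin N) (Fin N) (Module.End ℂ A⸨X⸩) :=
    Matrix.of fun i j => (if i = j ∧ j ∈ firstBlock e then 1 else 0) - opT t i j with hP
  have hPM : IsManin P := hM.diagonal_sub
    (d := Matrix.of fun i j => if i = j ∧ j ∈ firstBlock e then 1 else 0) fun i j x => by
      rw [Matrix.of_apply]
      split_ifs <;> simp
  let e' : Fin r ⊕ Fin p ≃ Fin N := (Equiv.sumComm _ _).trans e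
  -- The shift by 1 in the multiplier compensates the τ⁻¹ carried by the entries, so the relation
  -- between series becomes a relation between operators.
  have hmulK : ∀ (i : Fin N) (k : Fin r) (j : Fin p), opT t i (e (.inr k)) *
      mulOp (shift 1 (K k j)) = mulOp (series (t i (e (.inr k))) * K k j) * shift (-1) := by
    intro i k j
    rw [opT, Matrix.of_apply, mul_assoc, shift_mul_mulOp, shift_shift, neg_add_cancel, shift_zero,
      ← mul_assoc, mulOp_mul_mulOp]
    rfl
  have hsch := (hPM.submatrix e' e').cdet_schur (Matrix.of fun k j => mulOp (shift 1 (K k j)))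
    (1 - opT t') ?_ ?_
  · rw [Matrix.submatrix_submatrix] at hsch
    have h2 := hPM.cdet_submatrix_equiv (finSumFinEquiv.symm.trans e')
    rw [← h2]
    refine hsch.trans ?_
    congr 2
    ext1 i j
    change P (e (.inr i)) (e (.inr j)) = -opT t (e (.inr i)) (e (.inr j))
    rw [hP, Matrix.of_apply, if_neg (fun hh => inr_notMem_firstBlock e j hh.2), zero_sub]
  · intro i j
    change P (e (.inr i)) (e (.inl j)) = ∑ k, P (e (.inr i)) (e (.inr k)) *
      mulOp (shift 1 (K k j))
    have hne : e (.inr i) ≠ e (.inl j) := fun hh => absurd (e.injective hh) (by simp)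
    simp only [hP, Matrix.of_apply, inr_notMem_firstBlock, and_false, if_false, hne, false_and,
      zero_sub]
    have : ∀ k, -opT t (e (.inr i)) (e (.inr k)) * mulOp (shift 1 (K k j)) =
        -(mulOp (series (t (e (.inr i)) (e (.inr k))) * K k j) * shift (-1)) := by
      intro k
      rw [← hmulK]
      exact LinearMap.ext fun _ => rfl
    simp only [this]
    rw [Finset.sum_neg_distrib, ← Finset.sum_mul, ← mulOp_sum, ← hK2]
    rfl
  · intro i j
    change P (e (.inl i)) (e (.inl j)) = (1 - opT t') i j + ∑ k, P (e (.inl i)) (e (.inr k)) *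
      mulOp (shift 1 (K k j))
    have : ∀ k, P (e (.inl i)) (e (.inr k)) * mulOp (shift 1 (K k j)) =
        -(mulOp (series (t (e (.inl i)) (e (.inr k))) * K k j) * shift (-1)) := by
      intro k
      rw [← hmulK, hP, Matrix.of_apply, if_neg (fun hh => inr_notMem_firstBlock e k hh.2), zero_sub]
      exact LinearMap.ext fun _ => rfl
    simp only [this]
    have hone : (if e (.inl i) = e (.inl j) ∧ e (.inl j) ∈ firstBlock e then
        (1 : Module.End ℂ A⸨X⸩) else 0) = (1 : Matrix (Fin p) (Fin p) (Module.End ℂ A⸨X⸩)) i j := by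
      simp [inl_mem_firstBlock, Matrix.one_apply]
    have h3 : opT t (e (.inl i)) (e (.inl j)) = opT t' i j +
        ∑ k, mulOp (series (t (e (.inl i)) (e (.inr k))) * K k j) * shift (-1) := by
      rw [← Finset.sum_mul, ← mulOp_sum, opT, opT, Matrix.of_apply, Matrix.of_apply, ← add_mul,
        ← mulOp_add, ← hK1]
    rw [Finset.sum_neg_distrib, hP, Matrix.of_apply, hone, h3, Matrix.sub_apply]
    abel

/-- Both sides of `IsSchurComplement.cdet_eq` are alternating sums of operators of distinct degrees
-(k + r), which can be compared termwise. The term k = 0 identifies the factor cdet(-D), up to the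
sign (-1)^r, with the minor of the second block. -/
theorem IsSchurComplement.typedMinorSum_eq {A : Type*} [Ring A] [Algebra ℂ A]
    {t : Fin N → Fin N → ℕ → A} {t' : Fin p → Fin p → ℕ → A}
    (h : IsSchurComplement e t t') (hM : IsManin (opT t))
    (ht : ∀ i j, t i j 0 = if i = j then 1 else 0)
    (ht' : ∀ i j, t' i j 0 = if i = j then 1 else 0) (k : ℕ) (hk : k ≤ p) :
    typedMinorSum (firstBlock e) (opT t) k r =
      typedMinorSum (firstBlock e) (opT t) 0 r * minorSum k (opT t') := by
  have hdet := h.cdet_eq hM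
  rw [cdet_diagonal_sub_eq_typedMinorSum, cdet_one_sub_eq_minorSum, Finset.mul_sum,
    card_firstBlock_compl, card_firstBlock] at hdet
  set d := cdet (Matrix.of fun i j => -opT t (e (.inr i)) (e (.inr j)))
  have hd : IsHomog ⊤ (-(r : ℂ)) d := by
    have h := (IsHomogPS.cdet (d := fun _ => (-1 : ℂ)) (M := Matrix.of fun i j =>
      -opT t (e (.inr i)) (e (.inr j))) fun i j => (opT_isHomogPS t _ _).neg).isHomog
    refine h.congr ?_
    simp
  have hmul : ∀ k : Fin (p + 1), d * (-1 : ℤ) ^ (k : ℕ) • minorSum k (opT t') =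
      (-1 : ℤ) ^ (k : ℕ) • (d * minorSum k (opT t')) := fun k => mul_smul_comm _ _ _
  simp only [hmul] at hdet
  have hc : Function.Injective fun k : Fin (p + 1) => -(((k : ℕ) : ℂ) + r) := by
    intro i j hij
    have := Nat.cast_injective (add_right_cancel (neg_injective hij))
    exact Fin.ext this
  have heq := homog_eq_of_alternating_sum_eq Finset.univ (fun k : Fin (p + 1) => (k : ℕ)) hc
    (fun k _ => ?_) (fun k _ => ?_) hdet
  · have h0 := heq 0 (Finset.mem_univ _)
    have hk' := heq ⟨k, Nat.lt_succ_of_le hk⟩ (Finset.mem_univ _)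
    simp only [Fin.val_zero, minorSum_zero, mul_one] at h0 hk'
    rw [← h0, smul_mul_assoc] at hk'
    have hs : ((-1 : ℤ) ^ r * (-1 : ℤ) ^ r) = 1 := by
      rw [← mul_pow]; simp
    have := congrArg (fun z => (-1 : ℤ) ^ r • z) hk'
    simpa only [smul_smul, hs, one_smul] using this
  · obtain ⟨c, hc⟩ := typedMinorSum_isHomogPS (firstBlock e) ht k r
    rcases neg_one_pow_eq_or ℤ r with hs | hs
    · rw [hs, one_smul]; exact hc.isHomog
    · rw [hs, neg_one_smul]; exact hc.neg.isHomog
  · obtain ⟨c, hc⟩ := minorSum_isHomogPS ht' k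
    refine (hd.mul hc.isHomog).congr ?_
    ring

variable {h : Yangian p →ₐ[ℂ] Ugl N}

/-- The case k = p of the factorization expresses the central determinant as the minor of the second
block times an operator invertible over S. So that minor lies over S, hence so do all sums
containing the whole second block, and the commutator with τ u supplies the rest. -/
theorem IsSchurComplement.typedMinorSum_isHomog
    (hs : IsSchurComplement e (evFamily N) fun i j r => h (Yangian.t i j r))
    {S : Subalgebra ℂ (Ugl N)} (hB : (betheAlgebra (n := p) fun _ => 1).map h ≤ S)
    (hZ : Subalgebra.center ℂ (Ugl N) ≤ S) (a b : ℕ) (hb : b ≤ r) :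
    IsHomog S (-((a : ℂ) + b)) (typedMinorSum (firstBlock e) (capelli N) a b) := by
  have ht' : ∀ i j, h (Yangian.t i j 0) = if i = j then 1 else 0 := by
    intro i j
    rw [(Yangian.isRTT p).zero]
    split_ifs <;> simp
  have hb' := (map_betheAlgebra_le_iff h S).mp hB
  have heq := hs.typedMinorSum_eq (capelli_isManin N) (fun _ _ => rfl) ht'
  have hN : (p : ℂ) + r = N := by
    have := Fintype.card_congr e
    simp only [Fintype.card_sum, Fintype.card_fin] at this
    exact_mod_cast this
  have hfull : typedMinorSum (firstBlock e) (capelli N) p r = cdet (capelli N) := by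
    have := typedMinorSum_card_card (firstBlock e) (capelli N)
    rwa [card_firstBlock, card_firstBlock_compl] at this
  have hps : IsHomogPS (-(p : ℂ)) (1 : Ugl N)
      (minorSum p (opT fun i j r => h (Yangian.t i j r))) := by
    rw [minorSum_card, ← minor_univ]
    have := minor_isHomogPS (t := fun i j r => h (Yangian.t i j r)) ht' Finset.univ
    rwa [Finset.card_univ, Fintype.card_fin] at this
  obtain ⟨y, hy, -, hy2⟩ := hps.exists_inv (hb' p le_rfl)
  have h0 : IsHomog S (-(r : ℂ)) (typedMinorSum (firstBlock e) (capelli N) 0 r) := by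
    have h1 : typedMinorSum (firstBlock e) (capelli N) 0 r = cdet (capelli N) * y := by
      rw [← hfull, heq p le_rfl, mul_assoc, hy2, mul_one]
    rw [h1]
    refine (((cdet_capelli_isHomog_center N).mono hZ).mul hy).congr ?_
    rw [← hN]
    ring
  have htop : ∀ a : ℕ, IsHomog S (-((a : ℂ) + ((firstBlock e)ᶜ.card : ℂ)))
      (typedMinorSum (firstBlock e) (capelli N) a (firstBlock e)ᶜ.card) := by
    intro a
    rw [card_firstBlock_compl]
    by_cases ha : a ≤ p
    · rw [heq a ha]
      refine (h0.mul (hb' a ha)).congr ?_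
      ring
    · rw [typedMinorSum, Finset.sum_eq_zero]
      · exact IsHomog.zero
      · intro K hK
        have h1 := ((mem_typedSubsets _).mp hK).1
        have h2 := Finset.card_le_card (Finset.inter_subset_right (s₁ := K) (s₂ := firstBlock e))
        rw [card_firstBlock] at h2
        omega
  exact typedMinorSum_isHomog_of_top _ htop b (by rwa [card_firstBlock_compl]) a

/-- In the factorization the factor for k = 0 is a single minor with constant term 1. It can be
divided out over S, which leaves the generators of the image. The center is not needed in this
direction. -/
theorem IsSchurComplement.map_betheAlgebra_le
    (hs : IsSchurComplement e (evFamily N) fun i j r => h (Yangian.t i j r))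
    {S : Subalgebra ℂ (Ugl N)} (hS : ∀ a ≤ p, IsHomog S (-((a : ℂ) + r))
      (typedMinorSum (firstBlock e) (capelli N) a r)) :
    (betheAlgebra (n := p) fun _ => 1).map h ≤ S := by
  have ht' : ∀ i j, h (Yangian.t i j 0) = if i = j then 1 else 0 := by
    intro i j
    rw [(Yangian.isRTT p).zero]
    split_ifs <;> simp
  rw [map_betheAlgebra_le_iff]
  intro k hk
  have heq := hs.typedMinorSum_eq (capelli_isManin N) (fun _ _ => rfl) ht' k hk
  have hps : IsHomogPS (-(r : ℂ)) (1 : Ugl N)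
      (typedMinorSum (firstBlock e) (capelli N) 0 r) := by
    have h1 := typedMinorSum_card_compl_zero (firstBlock e) (capelli N)
    have h2 := minor_isHomogPS (t := evFamily N) (fun _ _ => rfl) (firstBlock e)ᶜ
    rw [card_firstBlock_compl] at h1 h2
    rwa [h1]
  obtain ⟨y, hy, hy1, -⟩ := hps.exists_inv ((hS 0 (Nat.zero_le _)).congr (by simp))
  have h1 : minorSum k (opT fun i j r => h (Yangian.t i j r)) =
      y * typedMinorSum (firstBlock e) (capelli N) k r := by
    rw [heq, ← mul_assoc, hy1, one_mul]
  rw [h1]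
  refine (hy.mul (hS k hk)).congr ?_
  ring

/-- The images of the Bethe subalgebras under Schur complements with respect to the two diagonal
blocks agree up to the center. -/
theorem IsSchurComplement.map_betheAlgebra_sup_center_le
    (hs : IsSchurComplement e (evFamily N) fun i j r => h (Yangian.t i j r))
    {h' : Yangian r →ₐ[ℂ] Ugl N}
    (hs' : IsSchurComplement ((Equiv.sumComm (Fin r) (Fin p)).trans e) (evFamily N)
      fun i j r => h' (Yangian.t i j r)) :
    (betheAlgebra (n := p) fun _ => 1).map h ⊔ Subalgebra.center ℂ (Ugl N) ≤
      (betheAlgebra (n := r) fun _ => 1).map h' ⊔ Subalgebra.center ℂ (Ugl N) := by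
  refine sup_le (hs.map_betheAlgebra_le fun a ha => ?_) le_sup_right
  have := hs'.typedMinorSum_isHomog le_sup_left le_sup_right r a ha
  rw [← firstBlock_compl, typedMinorSum_compl] at this
  exact this.congr (by ring)

end Schur

/-! ### The maps `φ_n` and `ψ_m` as Schur complements -/

section Omega

variable {A : Type*} [Ring A] {ι : Type*} [Fintype ι] [DecidableEq ι]

/-- The matrix of entries of a series of matrices. -/
def entries (F : (Matrix ι ι A)⟦X⟧) : Matrix ι ι A⟦X⟧ :=
  Matrix.of fun i j => PowerSeries.mk fun r => PowerSeries.coeff r F i j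

theorem entries_mul (F G : (Matrix ι ι A)⟦X⟧) : entries (F * G) = entries F * entries G := by
  ext i j r
  rw [entries, Matrix.of_apply, PowerSeries.coeff_mk, Matrix.mul_apply, PowerSeries.coeff_mul,
    Matrix.sum_apply, map_sum]
  simp only [PowerSeries.coeff_mul, Matrix.mul_apply, entries, Matrix.of_apply,
    PowerSeries.coeff_mk]
  exact Finset.sum_comm

theorem entries_one : entries (1 : (Matrix ι ι A)⟦X⟧) = 1 := by
  ext i j r
  rw [entries, Matrix.of_apply, PowerSeries.coeff_mk, PowerSeries.coeff_one, Matrix.one_apply]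
  by_cases hr : r = 0 <;> by_cases hij : i = j <;> simp [hr, hij, PowerSeries.coeff_one, Matrix.one_apply]

/-- The substitution `u ↦ -u`. -/
def negVar (A : Type*) [Ring A] : A⟦X⟧ →+* A⟦X⟧ where
  toFun f := PowerSeries.mk fun r => (-1) ^ r * PowerSeries.coeff r f
  map_one' := by
    ext r
    by_cases hr : r = 0 <;> simp [PowerSeries.coeff_one, hr]
  map_mul' f g := by
    ext r
    rw [PowerSeries.coeff_mk, PowerSeries.coeff_mul, PowerSeries.coeff_mul, Finset.mul_sum]
    refine Finset.sum_congr rfl fun x hx => ?_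
    rw [PowerSeries.coeff_mk, PowerSeries.coeff_mk, ← Finset.HasAntidiagonal.mem_antidiagonal.mp hx, pow_add,
      mul_assoc, mul_assoc, ← mul_assoc (PowerSeries.coeff x.1 f),
      ← ((Commute.neg_one_left (PowerSeries.coeff x.1 f)).pow_left x.2).eq]
    simp only [mul_assoc]
  map_zero' := by
    ext r
    simp
  map_add' f g := by
    ext r
    simp [mul_add]

theorem coeff_negVar (f : A⟦X⟧) (r : ℕ) :
    PowerSeries.coeff r (negVar A f) = (-1) ^ r * PowerSeries.coeff r f := by
  change PowerSeries.coeff r (PowerSeries.mk fun r => (-1) ^ r * PowerSeries.coeff r f) = _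
  rw [PowerSeries.coeff_mk]

variable {n : ℕ}

/-- The matrix of generating series of a family. -/
def seriesMat (t : Fin n → Fin n → ℕ → A) : Matrix (Fin n) (Fin n) A⟦X⟧ :=
  Matrix.of fun i j => PowerSeries.mk (t i j)

theorem seriesMat_mul_entries {t : Fin n → Fin n → ℕ → A} (ht : IsRTT t) :
    seriesMat t * entries (matTInv t) = 1 := by
  have h : seriesMat t = entries (matT t) := by
    ext i j r
    simp [seriesMat, entries, matT]
  rw [h, ← entries_mul, matT_mul_matTInv ht, entries_one]

theorem seriesMat_omegaFamily (t : Fin n → Fin n → ℕ → A) :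
    seriesMat (omegaFamily t) = (entries (matTInv t)).map (negVar A) := by
  ext i j r
  rw [Matrix.map_apply, coeff_negVar]
  simp [seriesMat, omegaFamily, entries]

/-- The family `ω(t')` for `t' = ω(t)` restricted to a block is the Schur complement of `t`. -/
theorem isSchurComplement_omegaFamily {N p r : ℕ} (e : Fin p ⊕ Fin r ≃ Fin N)
    {t : Fin N → Fin N → ℕ → A} (ht : IsRTT t)
    (ht' : IsRTT fun i j : Fin p => omegaFamily t (e (.inl i)) (e (.inl j))) :
    IsSchurComplement e t
      (omegaFamily fun i j : Fin p => omegaFamily t (e (.inl i)) (e (.inl j))) := by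
  set t₁ : Fin p → Fin p → ℕ → A := fun i j => omegaFamily t (e (.inl i)) (e (.inl j)) with ht₁
  set V := entries (matTInv t) with hV
  set T' := seriesMat (omegaFamily t₁) with hT'
  have hneg : ∀ f : A⟦X⟧, negVar A (negVar A f) = f := by
    intro f
    ext k
    rw [coeff_negVar, coeff_negVar, ← mul_assoc, ← pow_add, Even.neg_one_pow ⟨k, rfl⟩, one_mul]
  have h1 : ∀ i j, ∑ x, PowerSeries.mk (t i x) * V x j = (1 : Matrix (Fin N) (Fin N) A⟦X⟧) i j := by
    intro i j
    rw [← seriesMat_mul_entries ht, Matrix.mul_apply]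
    rfl
  -- The two substitutions u ↦ -u cancel, so T' is the inverse of the first diagonal block of
  -- T(u)⁻¹.
  have h2 : ∀ i j, ∑ l, V (e (.inl i)) (e (.inl l)) * T' l j =
      (1 : Matrix (Fin p) (Fin p) A⟦X⟧) i j := by
    have hmap : (seriesMat t₁ * entries (matTInv t₁)).map (negVar A) =
        (seriesMat t₁).map (negVar A) * T' := by
      rw [hT', seriesMat_omegaFamily, Matrix.map_mul]
    rw [seriesMat_mul_entries ht', Matrix.map_one _ (map_zero _) (map_one _)] at hmap
    intro i j
    rw [hmap, Matrix.mul_apply]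
    refine Finset.sum_congr rfl fun l _ => ?_
    congr 1
    have h3 : seriesMat t₁ i l = seriesMat (omegaFamily t) (e (.inl i)) (e (.inl l)) := rfl
    rw [Matrix.map_apply, h3, seriesMat_omegaFamily, Matrix.map_apply, hneg]
  -- In block form, T V = 1 gives A V₁₁ + B V₂₁ = 1 and C V₁₁ + D V₂₁ = 0. Multiplying by T' = V₁₁⁻¹
  -- on the right gives A = T' + B K and C = D K for K = -V₂₁ T', without inverting D.
  let K : Fin r → Fin p → A⟦X⟧ := fun k j => -∑ l, V (e (.inr k)) (e (.inl l)) * T' l j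
  have h3 : ∀ (x : Fin N) (j : Fin p), PowerSeries.mk (t x (e (.inl j))) =
      ∑ l, (1 : Matrix (Fin N) (Fin N) A⟦X⟧) x (e (.inl l)) * T' l j +
        ∑ k, PowerSeries.mk (t x (e (.inr k))) * K k j := by
    intro x j
    have h4 : ∑ l, (1 : Matrix (Fin N) (Fin N) A⟦X⟧) x (e (.inl l)) * T' l j =
        ∑ y, PowerSeries.mk (t x y) * ∑ l, V y (e (.inl l)) * T' l j := by
      simp only [← h1, Finset.sum_mul, Finset.mul_sum, mul_assoc]
      exact Finset.sum_comm
    rw [h4, ← e.sum_comp, Fintype.sum_sum_type]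
    simp only [h2, K, mul_neg, Finset.sum_neg_distrib, add_neg_cancel_right]
    simp [Matrix.one_apply]
  have hser : ∀ a : ℕ → A, series a = HahnSeries.ofPowerSeries ℤ A (PowerSeries.mk a) :=
    fun _ => rfl
  refine ⟨fun k j => HahnSeries.ofPowerSeries ℤ A (K k j), fun i j => ?_, fun i j => ?_⟩
  · simp only [hser, ← map_mul, ← map_sum, ← map_add]
    congr 1
    rw [h3 (e (.inl i)) j]
    congr 1
    have : ∀ l, (1 : Matrix (Fin N) (Fin N) A⟦X⟧) (e (.inl i)) (e (.inl l)) =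
        (1 : Matrix (Fin p) (Fin p) A⟦X⟧) i l := by
      intro l
      simp [Matrix.one_apply]
    simp only [this]
    rw [← Matrix.mul_apply, one_mul]
    rfl
  · simp only [hser, ← map_mul, ← map_sum]
    congr 1
    rw [h3 (e (.inr i)) j, Finset.sum_eq_zero, zero_add]
    intro l _
    rw [Matrix.one_apply_ne, zero_mul]
    exact fun hh => absurd (e.injective hh) (by simp)

end Omega

section Maps

variable {A B : Type*} [Ring A] [Algebra ℂ A] [Ring B] [Algebra ℂ B] {n : ℕ}

theorem IsRTT.map {t : Fin n → Fin n → ℕ → A} (ht : IsRTT t) (h : A →ₐ[ℂ] B) :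
    IsRTT fun i j r => h (t i j r) where
  zero i j := by
    rw [ht.zero]
    split_ifs <;> simp
  rel i j k l r s := by
    simp only [← map_mul, ← map_sub, ht.rel]

/-- Homomorphisms preserve the inverse series because a one-sided inverse of an invertible series is
the inverse. This allows ω to be computed after evaluation, directly in U(gl_N). -/
theorem omegaFamily_map {t : Fin n → Fin n → ℕ → A} (ht : IsRTT t) (h : A →ₐ[ℂ] B) (i j : Fin n)
    (r : ℕ) : h (omegaFamily t i j r) = omegaFamily (fun i j r => h (t i j r)) i j r := by
  have hm : PowerSeries.map (h : A →+* B).mapMatrix (matT t) = matT fun i j r => h (t i j r) := by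
    ext r i j
    simp [matT]
  have hinv : PowerSeries.map (h : A →+* B).mapMatrix (matTInv t) =
      matTInv fun i j r => h (t i j r) := by
    refine left_inv_eq_right_inv (a := matT fun i j r => h (t i j r)) ?_
      (matT_mul_matTInv (ht.map h))
    rw [← hm, ← map_mul, matTInv_mul_matT ht, map_one]
  rw [omegaFamily, omegaFamily, ← hinv, map_mul, map_pow, map_neg, map_one, PowerSeries.coeff_map]
  rfl

theorem omega_t (i j : Fin n) (r : ℕ) :
    omega n (Yangian.t i j r) = omegaFamily Yangian.t i j r := Yangian.lift_t _ _ _ _ _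

theorem ev_omega_t (i j : Fin n) (r : ℕ) :
    ev n (omega n (Yangian.t i j r)) = omegaFamily (evFamily n) i j r := by
  rw [omega_t, omegaFamily_map (Yangian.isRTT n)]
  simp only [ev, Yangian.lift_t]

/-- Conjugating a block embedding by `ω` gives a Schur complement after evaluation. -/
theorem isSchurComplement_conj {N p r : ℕ} (e : Fin p ⊕ Fin r ≃ Fin N)
    (f : Yangian p →ₐ[ℂ] Yangian N)
    (hf : ∀ i j s, f (Yangian.t i j s) = Yangian.t (e (.inl i)) (e (.inl j)) s) :
    IsSchurComplement e (evFamily N) fun i j s =>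
      ((ev N).comp ((omega N).comp (f.comp (omega p)))) (Yangian.t i j s) := by
  have hg : ∀ i j s, ((ev N).comp ((omega N).comp f)) (Yangian.t i j s) =
      omegaFamily (evFamily N) (e (.inl i)) (e (.inl j)) s := by
    intro i j s
    rw [AlgHom.comp_apply, AlgHom.comp_apply, hf, ev_omega_t]
  have hrtt : IsRTT fun i j : Fin p => omegaFamily (evFamily N) (e (.inl i)) (e (.inl j)) := by
    have := (Yangian.isRTT p).map ((ev N).comp ((omega N).comp f))
    simpa only [hg] using this
  have h := isSchurComplement_omegaFamily e (evFamily_isRTT N) hrtt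
  convert h using 1
  funext i j s
  change ((ev N).comp ((omega N).comp f)) (omega p (Yangian.t i j s)) = _
  rw [omega_t, omegaFamily_map (Yangian.isRTT p)]
  simp only [hg]

end Maps

end BetheDuality

end

theorem corollary3p3 (n m : ℕ) :
    (BetheDuality.betheAlgebra (n := n) (fun _ => 1)).map
        ((BetheDuality.ev (n + m)).comp (BetheDuality.phi n m)) ⊔
      Subalgebra.center ℂ (BetheDuality.Ugl (n + m)) =
    (BetheDuality.betheAlgebra (n := m) (fun _ => 1)).map
        ((BetheDuality.ev (n + m)).comp (BetheDuality.psi n m)) ⊔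
      Subalgebra.center ℂ (BetheDuality.Ugl (n + m)) := by
  have hφ := BetheDuality.isSchurComplement_conj finSumFinEquiv (BetheDuality.iota n m)
    fun i j s => BetheDuality.Yangian.lift_t _ _ _ _ _
  -- The same statement with the last m indices as first block. Exchanging the blocks once more
  -- restores the original labelling, so each Schur complement serves as the partner of the other.
  have hψ := BetheDuality.isSchurComplement_conj
    ((Equiv.sumComm (Fin m) (Fin n)).trans finSumFinEquiv) (BetheDuality.jota n m)
    fun i j s => BetheDuality.Yangian.lift_t _ _ _ _ _
  exact le_antisymm (hφ.map_betheAlgebra_sup_center_le hψ) (hψ.map_betheAlgebra_sup_center_le hφ)
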